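/- Let $G$ be a finite abelian group and let $\underline{A}_G$ be its Burnside Tambara functor: $\underline{A}_G(G/H)=A(H)$ is the Burnside ring of $H$ for every subgroup $H\le G$, and for $K\le H\le G$ the restriction $\mathrm{res}^H_K$ restricts the action, the transfer $\mathrm{tr}_K^H$ is induced by $X\mapsto H\times_K X$, the norm $\mathrm{N}_K^H$ is the polynomial extension to formal differences of $X\mapsto \mathrm{Map}_K(H,X)$, and there are conjugation maps $c_g\colon A(H)\to A(H^g)$ with $H^g=g^{-1}Hg$. An ideal $\mathscr I$ of $\underline{A}_G$ is a family of ring ideals $\mathscr I(G/H)\subseteq A(H)$, $H\le G$, closed under restriction, transfer and conjugation and such that $\mathrm N_K^H(\mathscr I(G/K))\subseteq \mathscr I(G/H)+\mathrm N_K^H(0)$. The product $\mathscr I\mathscr J$ consists of the elements $f_+(ab)$ for maps of finite $G$-sets $f\colon A\to X$, $a\in\mathscr I(A)$, $b\in\mathscr J(A)$, where $f_+$ is the transfer along $f$ (ideals and $\underline{A}_G$ being extended from orbits to finite $G$-sets by taking products over orbits). An ideal $\mathscr P$, not equal to the whole of $\underline{A}_G$, is prime if $\mathscr I\mathscr J\subseteq\mathscr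 P$ implies $\mathscr I\subseteq \mathscr P$ or $\mathscr J\subseteq\mathscr P$ for all ideals $\mathscr I,\mathscr J$. For $p$ a prime number or $0$, $\mathscr P$ lies over $p$ if $\mathscr P(G/e)=(p)$ in $A(e)=\mathbb Z$. Let $p$ be a prime number or $0$. (1) If $\mathscr P$ is a prime ideal of $\underline{A}_G$ lying over $p$, then $H/K\in\mathscr P(G/H)$ for all subgroups $K\le H\le G$ with $p\mid |H:K|$. (2) If $p$ is a prime number and $G$ is a $p$-group, then the only prime ideal of $\underline{A}_G$ lying over $p$ is $\mathfrak p_{e,p}$. That is, $\mathfrak p_{e,p}$ is a prime ideal lying over $p$, and every prime ideal lying over $p$ is equal to it. Here, for a subgroup $C\le G$, $$\mathfrak p_{C,p}(G/H)=\bigcap_{I}\ker\bigl(A(H)\to\mathbb Z/p\mathbb Z,\ X\mapsto |X^I| \bmod p\bigr),$$ the intersection being over all subgroups $I\le H$ that are $G$-conjugate to a subgroup of $C$. -/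

import Mathlib

universe u v

/-! ### Grothendieck ring of a commutative semiring -/

/-- The Grothendieck ring of a commutative semiring `S`: the ring of formal differences of elements
of `S`. -/
def GrothendieckRing (S : Type u) [CommSemiring S] : Type u :=
  Algebra.GrothendieckAddGroup S

namespace GrothendieckRing

section
variable {S : Type u} [CommSemiring S]

noncomputable instance : AddCommGroup (GrothendieckRing S) :=
  inferInstanceAs (AddCommGroup (Algebra.GrothendieckAddGroup S))

/-- The canonical additive map from `S` to its Grothendieck ring. -/
noncomputable def ofAdd : S →+ GrothendieckRing S :=
  Algebra.GrothendieckAddGroup.of (M := S)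

/-- Additive maps from `S` to an abelian group extend to the Grothendieck ring. -/
noncomputable def liftAdd {A : Type v} [AddCommGroup A] (f : S →+ A) : GrothendieckRing S →+ A :=
  Algebra.GrothendieckAddGroup.lift f

@[simp] theorem liftAdd_ofAdd {A : Type v} [AddCommGroup A] (f : S →+ A) (s : S) :
    liftAdd f (ofAdd s) = f s :=
  DFunLike.congr_fun (Algebra.GrothendieckAddGroup.lift.symm_apply_apply f) s

theorem exists_sub (a : GrothendieckRing S) : ∃ x y : S, a = ofAdd x - ofAdd y := by
  induction a using AddLocalization.ind with
  | _ p =>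
    obtain ⟨x, y, hy⟩ := p
    refine ⟨x, y, ?_⟩
    have : (AddLocalization.mk x ⟨y, hy⟩ : Algebra.GrothendieckAddGroup S) =
      Algebra.GrothendieckAddGroup.of x - Algebra.GrothendieckAddGroup.of y := by
      simp only [Algebra.GrothendieckAddGroup.of, AddSubmonoid.LocalizationMap.toAddMonoidHom_apply,
        ← AddLocalization.mk_zero_eq_addMonoidOf_mk]
      rw [Algebra.GrothendieckAddGroup.mk_sub_mk]
      simp
    exact this

theorem addHom_ext {A : Type v} [AddCommGroup A] {f g : GrothendieckRing S →+ A}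
    (h : ∀ s, f (ofAdd s) = g (ofAdd s)) : f = g := by
  ext a
  obtain ⟨x, y, rfl⟩ := exists_sub a
  simp [h]

theorem ofAdd_eq_iff {x y : S} : ofAdd x = ofAdd y ↔ ∃ k, k + x = k + y := by
  constructor
  · intro h
    have h' := (AddSubmonoid.LocalizationMap.eq_iff_exists
      (AddLocalization.addMonoidOf (⊤ : AddSubmonoid S))).1 h
    obtain ⟨c, hc⟩ := h'
    exact ⟨c, hc⟩
  · rintro ⟨k, hk⟩
    have := congrArg (ofAdd (S := S)) hk
    simpa using this

/-- Multiplication of formal differences, `(x - y) (z - w) = (xz + yw) - (xw + yz)`. -/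
noncomputable def mulHom : GrothendieckRing S →+ GrothendieckRing S →+ GrothendieckRing S :=
  liftAdd
    { toFun := fun s => liftAdd (ofAdd.comp (AddMonoidHom.mulLeft s))
      map_zero' := addHom_ext fun t => by simp
      map_add' := fun s s' => addHom_ext fun t => by simp [add_mul] }

noncomputable instance : Mul (GrothendieckRing S) := ⟨fun a b => mulHom a b⟩

noncomputable instance : One (GrothendieckRing S) := ⟨ofAdd 1⟩

theorem mul_def (a b : GrothendieckRing S) : a * b = mulHom a b := rfl

theorem ofAdd_mul (s t : S) : (ofAdd (s * t) : GrothendieckRing S) = ofAdd s * ofAdd t := by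
  simp [mul_def, mulHom]

theorem ofAdd_one : (ofAdd 1 : GrothendieckRing S) = 1 := rfl

theorem left_distrib' (a b c : GrothendieckRing S) : a * (b + c) = a * b + a * c := by
  simp [mul_def]

theorem right_distrib' (a b c : GrothendieckRing S) : (a + b) * c = a * c + b * c := by
  simp [mul_def]

theorem sub_mul' (a b c : GrothendieckRing S) : (a - b) * c = a * c - b * c := by
  simp [mul_def]

theorem mul_sub' (a b c : GrothendieckRing S) : a * (b - c) = a * b - a * c := by
  simp [mul_def]

noncomputable instance : CommRing (GrothendieckRing S) :=
  { (inferInstance : AddCommGroup (GrothendieckRing S)),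
    (inferInstance : Mul (GrothendieckRing S)),
    (inferInstance : One (GrothendieckRing S)) with
    left_distrib := left_distrib'
    right_distrib := right_distrib'
    zero_mul := fun a => by simp [mul_def]
    mul_zero := fun a => by simp [mul_def]
    mul_assoc := fun a b c => by
      obtain ⟨x, y, rfl⟩ := exists_sub a
      obtain ⟨z, w, rfl⟩ := exists_sub b
      obtain ⟨s, t, rfl⟩ := exists_sub c
      simp only [sub_mul', mul_sub', ← ofAdd_mul, mul_assoc]
    one_mul := fun a => by
      obtain ⟨x, y, rfl⟩ := exists_sub a
      simp only [mul_sub', ← ofAdd_one, ← ofAdd_mul, one_mul]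
    mul_one := fun a => by
      obtain ⟨x, y, rfl⟩ := exists_sub a
      simp only [sub_mul', ← ofAdd_one, ← ofAdd_mul, mul_one]
    mul_comm := fun a b => by
      obtain ⟨x, y, rfl⟩ := exists_sub a
      obtain ⟨z, w, rfl⟩ := exists_sub b
      simp only [sub_mul', mul_sub', ← ofAdd_mul, mul_comm]
      abel }

/-- The canonical semiring homomorphism from `S` to its Grothendieck ring. -/
noncomputable def of : S →+* GrothendieckRing S :=
  { ofAdd with
    map_one' := ofAdd_one
    map_mul' := ofAdd_mul }

theorem of_eq_ofAdd (s : S) : of s = ofAdd s := rfl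

/-- A semiring homomorphism to a ring extends to the Grothendieck ring. -/
noncomputable def lift {R : Type v} [CommRing R] (f : S →+* R) : GrothendieckRing S →+* R :=
  { liftAdd f.toAddMonoidHom with
    map_one' := by
      change liftAdd _ (ofAdd 1) = 1
      simp
    map_mul' := fun a b => by
      obtain ⟨x, y, rfl⟩ := exists_sub a
      obtain ⟨z, w, rfl⟩ := exists_sub b
      simp only [ZeroHom.toFun_eq_coe, AddMonoidHom.toZeroHom_coe, sub_mul, mul_sub, ← ofAdd_mul,
        map_sub, liftAdd_ofAdd]
      simp }

@[simp] theorem lift_of {R : Type v} [CommRing R] (f : S →+* R) (s : S) :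
    lift f (of s) = f s :=
  liftAdd_ofAdd f.toAddMonoidHom s

@[simp] theorem liftAdd_of {A : Type v} [AddCommGroup A] (f : S →+ A) (s : S) :
    liftAdd f (of s) = f s :=
  liftAdd_ofAdd f s

end

/-! ### Polynomial extension -/

section
variable {S : Type u} [CommSemiring S] {A : Type v} [AddCommGroup A]

/-- The `(n + 1)`-st iterated differences of `f` vanish. -/
def IsPolyOfDegreeLE (f : S → A) (n : ℕ) : Prop :=
  ∀ x y : S, ∑ j ∈ Finset.range (n + 2),
    ((-1) ^ j * ((n + 1).choose j : ℤ)) • f (x + j • y) = 0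

/-- The value at `x - y` of the polynomial extension. -/
def polyFormula (f : S → A) (n : ℕ) (x y : S) : A :=
  ∑ j ∈ Finset.range (n + 1), ((-1) ^ j * ((n + 1).choose (j + 1) : ℤ)) • f (x + j • y)

theorem one_sub_pow_eq {R : Type*} [CommRing R] (v : R) (n : ℕ) :
    (1 - v) ^ n = ∑ j ∈ Finset.range (n + 1), ((-1) ^ j * (n.choose j : ℤ)) • v ^ j := by
  rw [sub_eq_neg_add, add_pow]
  refine Finset.sum_congr rfl fun j _ => ?_
  rw [neg_pow]
  simp only [one_pow, mul_one, zsmul_eq_mul]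
  push_cast
  ring

theorem mul_formula_eq {R : Type*} [CommRing R] (v : R) (n : ℕ) :
    v * ∑ j ∈ Finset.range (n + 1), ((-1) ^ j * ((n + 1).choose (j + 1) : ℤ)) • v ^ j
      = 1 - (1 - v) ^ (n + 1) := by
  rw [one_sub_pow_eq, Finset.mul_sum, Finset.sum_range_succ' _ (n + 1)]
  simp only [zsmul_eq_mul, Nat.choose_zero_right, pow_zero]
  push_cast
  rw [sub_add_eq_sub_sub_swap, eq_sub_iff_add_eq, ← Finset.sum_add_distrib]
  rw [Finset.sum_eq_zero]
  · simp
  · intro j _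
    ring

theorem polyFormula_add_right {f : S → A} {n : ℕ} (hf : IsPolyOfDegreeLE f n) (x y z : S) :
    polyFormula f n (x + z) (y + z) = polyFormula f n x y := by
  let L : AddMonoidAlgebra ℤ S →+ A :=
    (Finsupp.liftAddHom (fun s : S => (zmultiplesHom A) (f s))).comp
      (AddMonoidAlgebra.coeffAddEquiv (R := ℤ) (M := S)).toAddMonoidHom
  let m : S → AddMonoidAlgebra ℤ S := fun s => AddMonoidAlgebra.single s 1
  have hL (s : S) (k : ℤ) : L (AddMonoidAlgebra.single s k) = k • f s := by
    simp [L]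
  have hLm (s : S) : L (m s) = f s := by simp [m, hL]
  have hm (s t : S) : m (s + t) = m s * m t := by
    simp [m, AddMonoidAlgebra.single_mul_single]
  have hmp (s : S) (j : ℕ) : m (j • s) = m s ^ j := by
    simp [m, AddMonoidAlgebra.single_pow]
  have hann (r : AddMonoidAlgebra ℤ S) (t : S) : L (r * (1 - m t) ^ (n + 1)) = 0 := by
    induction r using AddMonoidAlgebra.induction_linear with
    | zero => simp
    | add a b ha hb => rw [add_mul, map_add, ha, hb, add_zero]
    | single s k =>
      have : (AddMonoidAlgebra.single s k : AddMonoidAlgebra ℤ S) = k • m s := by simp [m]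
      rw [this, smul_mul_assoc, map_zsmul, one_sub_pow_eq, Finset.mul_sum, map_sum]
      simp only [mul_smul_comm, map_zsmul, ← hmp, ← hm, hLm]
      rw [hf s t, smul_zero]
  let Q : AddMonoidAlgebra ℤ S → AddMonoidAlgebra ℤ S := fun v =>
    ∑ j ∈ Finset.range (n + 1), ((-1) ^ j * ((n + 1).choose (j + 1) : ℤ)) • v ^ j
  have hQ (v) : v * Q v = 1 - (1 - v) ^ (n + 1) := mul_formula_eq v n
  have hF (s t : S) : polyFormula f n s t = L (m s * Q (m t)) := by
    simp only [polyFormula, Q, Finset.mul_sum, map_sum, mul_smul_comm, map_zsmul, ← hmp, ← hm, hLm]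
  rw [hF, hF, ← sub_eq_zero, ← map_sub]
  have key : m (x + z) * Q (m (y + z)) - m x * Q (m y)
      = m (x + z) * Q (m (y + z)) * (1 - m y) ^ (n + 1)
        - m x * Q (m y) * (1 - m (y + z)) ^ (n + 1) := by
    have h1 := hQ (m y)
    have h2 := hQ (m (y + z))
    rw [hm y z] at h2
    rw [hm x z, hm y z]
    linear_combination (-(m x * m z * Q (m y * m z))) * h1 + (m x * Q (m y)) * h2
  rw [key, map_sub, hann, hann, sub_zero]

/-- The polynomial extension to the Grothendieck ring of a function `f` of degree at most `n` from a
semiring to an abelian group: the only function of degree at most `n` that agrees with `f` on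
`S`. At a formal difference `x - y` it takes the value
`∑ j ≤ n, (-1) ^ j * (n + 1).choose (j + 1) * f (x + j y)`. -/
noncomputable def polyExt (f : S → A) (n : ℕ) (a : GrothendieckRing S) : A :=
  polyFormula f n (exists_sub a).choose (exists_sub a).choose_spec.choose

theorem polyExt_sub {f : S → A} {n : ℕ} (hf : IsPolyOfDegreeLE f n) (x y : S) :
    polyExt f n (of x - of y) = polyFormula f n x y := by
  have h := (exists_sub (of x - of y)).choose_spec.choose_spec
  set x' := (exists_sub (of x - of y)).choose
  set y' := (exists_sub (of x - of y)).choose_spec.choose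
  change polyFormula f n x' y' = _
  rw [of_eq_ofAdd, of_eq_ofAdd, sub_eq_sub_iff_add_eq_add, ← map_add, ← map_add,
    ofAdd_eq_iff] at h
  obtain ⟨k, hk⟩ := h
  rw [← polyFormula_add_right hf x' y' (y + k), ← polyFormula_add_right hf x y (y' + k)]
  congr 1
  · rw [← add_assoc, ← add_assoc, add_comm (x' + y), add_comm (x + y'), hk]
    rfl
  · abel

theorem polyExt_of {f : S → A} {n : ℕ} (hf : IsPolyOfDegreeLE f n) (x : S) :
    polyExt f n (of x) = f x := by
  have h := polyExt_sub hf x 0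
  rw [map_zero, sub_zero] at h
  rw [h, polyFormula]
  simp only [smul_zero, add_zero, ← Finset.sum_smul]
  have := mul_formula_eq (1 : ℤ) n
  simp only [one_pow, smul_eq_mul, mul_one, one_mul, sub_self] at this
  rw [this]
  simp

end
end GrothendieckRing

/-! ### Finite `H`-sets and the Burnside ring -/

/-- A finite set with an action of the group `H`. -/
structure FinGSet (H : Type u) [Group H] : Type (u + 1) where
  carrier : Type u
  [action : MulAction H carrier]
  [finite : Finite carrier]

namespace FinGSet

attribute [instance] FinGSet.action FinGSet.finite

/-- Isomorphism of `H`-sets. -/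
def Iso {H : Type u} [Group H] (X Y : FinGSet H) : Prop :=
  ∃ e : X.carrier ≃ Y.carrier, ∀ (h : H) (x : X.carrier), e (h • x) = h • e x

theorem Iso.symm {H : Type u} [Group H] {X Y : FinGSet H} : Iso X Y → Iso Y X := by
  rintro ⟨e, he⟩
  exact ⟨e.symm, fun h y => e.injective (by simp [he])⟩

/-- Isomorphism of finite `H`-sets is an equivalence relation. -/
instance setoid (H : Type u) [Group H] : Setoid (FinGSet H) where
  r := Iso
  iseqv :=
    { refl := fun _ => ⟨Equiv.refl _, fun _ _ => rfl⟩
      symm := Iso.symm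
      trans := by
        rintro X Y Z ⟨e, he⟩ ⟨f, hf⟩
        exact ⟨e.trans f, fun h x => by simp [he, hf]⟩ }

end FinGSet

/-- The isomorphism classes of finite `H`-sets. -/
def FinGSetClass (H : Type u) [Group H] : Type (u + 1) :=
  Quotient (FinGSet.setoid H)

namespace FinGSetClass

variable {H : Type u} [Group H]

/-- The class of a finite `H`-set. -/
def mk (X : Type u) [MulAction H X] [Finite X] : FinGSetClass H :=
  Quotient.mk _ (FinGSet.mk X)

theorem mk_eq {X Y : Type u} [MulAction H X] [Finite X] [MulAction H Y] [Finite Y] (e : X ≃ Y)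
    (he : ∀ (h : H) (x : X), e (h • x) = h • e x) : mk (H := H) X = mk Y :=
  Quotient.sound ⟨e, he⟩

theorem ind {p : FinGSetClass H → Prop}
    (h : ∀ (X : Type u) [MulAction H X] [Finite X], p (mk X)) (a : FinGSetClass H) : p a :=
  Quotient.ind (fun X => h X.carrier) a

/-- An isomorphism-invariant construction descends to isomorphism classes. -/
def lift {T : Type v} (f : ∀ (X : Type u) [MulAction H X] [Finite X], T)
    (hf : ∀ (X Y : Type u) [MulAction H X] [Finite X] [MulAction H Y] [Finite Y] (e : X ≃ Y),
      (∀ (h : H) (x : X), e (h • x) = h • e x) → f X = f Y) (a : FinGSetClass H) : T :=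
  Quotient.lift (fun X : FinGSet H => f X.carrier)
    (fun X Y h => Exists.elim h fun e he => hf X.carrier Y.carrier e he) a

@[simp] theorem lift_mk {T : Type v} (f : ∀ (X : Type u) [MulAction H X] [Finite X], T) (hf)
    (X : Type u) [MulAction H X] [Finite X] : lift f hf (mk X) = f X := rfl

/-- Disjoint union. -/
instance : Add (FinGSetClass H) :=
  ⟨fun a b => lift (fun X _ _ => lift (fun Y _ _ => mk (X ⊕ Y))
    (fun Y Y' _ _ _ _ e he => mk_eq (Equiv.sumCongr (Equiv.refl X) e)
      (by rintro h (x | y) <;> simp [he])) b)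
    (fun X X' _ _ _ _ e he => by
      induction b using ind with
      | _ Y =>
        exact mk_eq (Equiv.sumCongr e (Equiv.refl Y)) (by rintro h (x | y) <;> simp [he])) a⟩

/-- Cartesian product with the diagonal action. -/
instance : Mul (FinGSetClass H) :=
  ⟨fun a b => lift (fun X _ _ => lift (fun Y _ _ => mk (X × Y))
    (fun Y Y' _ _ _ _ e he => mk_eq (Equiv.prodCongr (Equiv.refl X) e)
      (by rintro h ⟨x, y⟩; simp [he])) b)
    (fun X X' _ _ _ _ e he => by
      induction b using ind with
      | _ Y =>
        exact mk_eq (Equiv.prodCongr e (Equiv.refl Y)) (by rintro h ⟨x, y⟩; simp [he])) a⟩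

instance emptyAction : MulAction H PEmpty.{u + 1} where
  smul _ x := x
  one_smul _ := rfl
  mul_smul _ _ _ := rfl

/-- The empty set. -/
instance : Zero (FinGSetClass H) := ⟨mk PEmpty.{u + 1}⟩

/-- The one-point set. -/
instance : One (FinGSetClass H) := ⟨mk PUnit.{u + 1}⟩

theorem mk_add (X Y : Type u) [MulAction H X] [Finite X] [MulAction H Y] [Finite Y] :
    (mk X + mk Y : FinGSetClass H) = mk (X ⊕ Y) := rfl

theorem mk_mul (X Y : Type u) [MulAction H X] [Finite X] [MulAction H Y] [Finite Y] :
    (mk X * mk Y : FinGSetClass H) = mk (X × Y) := rfl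

theorem zero_def : (0 : FinGSetClass H) = mk PEmpty.{u + 1} := rfl

theorem one_def : (1 : FinGSetClass H) = mk PUnit.{u + 1} := rfl

theorem add_comm' (a b : FinGSetClass H) : a + b = b + a := by
  induction a using ind with
  | _ X =>
  induction b using ind with
  | _ Y =>
  exact mk_eq (Equiv.sumComm X Y) (by rintro h (x | y) <;> rfl)

theorem mul_comm' (a b : FinGSetClass H) : a * b = b * a := by
  induction a using ind with
  | _ X =>
  induction b using ind with
  | _ Y =>
  exact mk_eq (Equiv.prodComm X Y) (by rintro h ⟨x, y⟩; rfl)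

theorem zero_add' (a : FinGSetClass H) : 0 + a = a := by
  induction a using ind with
  | _ X => exact mk_eq (Equiv.emptySum PEmpty X) (by rintro h (x | y); exacts [x.elim, rfl])

theorem one_mul' (a : FinGSetClass H) : 1 * a = a := by
  induction a using ind with
  | _ X => exact mk_eq (Equiv.punitProd X) (by rintro h ⟨x, y⟩; rfl)

theorem zero_mul' (a : FinGSetClass H) : 0 * a = 0 := by
  induction a using ind with
  | _ X => exact mk_eq (Equiv.pemptyProd X) (by rintro h ⟨x, y⟩; exact x.elim)

theorem right_distrib' (a b c : FinGSetClass H) : (a + b) * c = a * c + b * c := by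
  induction a using ind with
  | _ X =>
  induction b using ind with
  | _ Y =>
  induction c using ind with
  | _ Z => exact mk_eq (Equiv.sumProdDistrib X Y Z) (by rintro h ⟨x | y, z⟩ <;> rfl)

instance : CommSemiring (FinGSetClass H) where
  add_assoc a b c := by
    induction a using ind with
    | _ X =>
    induction b using ind with
    | _ Y =>
    induction c using ind with
    | _ Z => exact mk_eq (Equiv.sumAssoc X Y Z) (by rintro h ((x | y) | z) <;> rfl)
  mul_assoc a b c := by
    induction a using ind with
    | _ X =>
    induction b using ind with
    | _ Y =>
    induction c using ind with
    | _ Z => exact mk_eq (Equiv.prodAssoc X Y Z) (by rintro h ⟨⟨x, y⟩, z⟩; rfl)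
  add_comm := add_comm'
  mul_comm := mul_comm'
  zero_add := zero_add'
  add_zero a := by rw [add_comm', zero_add']
  one_mul := one_mul'
  mul_one a := by rw [mul_comm', one_mul']
  zero_mul := zero_mul'
  mul_zero a := by rw [mul_comm', zero_mul']
  right_distrib := right_distrib'
  left_distrib a b c := by rw [mul_comm', right_distrib', mul_comm' b, mul_comm' c]
  nsmul := nsmulRec

/-! #### Restriction, marks, transfer and norm of actual sets -/

variable {K : Type u} [Group K]

/-- Let `K` act on an `H`-set through a group homomorphism `f : K →* H`. -/
def res (f : K →* H) : FinGSetClass H →+* FinGSetClass K where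
  toFun := lift (fun X _ _ => letI := MulAction.compHom X f; mk X)
    (fun X Y _ _ _ _ e he => by
      let _ := MulAction.compHom X f
      let _ := MulAction.compHom Y f
      exact mk_eq e fun k x => he (f k) x)
  map_zero' := by
    let _ := MulAction.compHom PEmpty.{u + 1} f
    refine @mk_eq K _ _ _ (_) _ (_) _ (Equiv.refl PEmpty.{u + 1}) ?_
    rintro h ⟨⟩
  map_one' := by
    refine @mk_eq K _ _ _ (_) _ (_) _ (Equiv.refl PUnit.{u + 1}) ?_
    intro h x
    rfl
  map_add' a b := by
    induction a using ind with
    | _ X =>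
    induction b using ind with
    | _ Y =>
    refine @mk_eq K _ _ _ (_) _ (_) _ (Equiv.refl (X ⊕ Y)) ?_
    rintro h (x | y) <;> rfl
  map_mul' a b := by
    induction a using ind with
    | _ X =>
    induction b using ind with
    | _ Y =>
    refine @mk_eq K _ _ _ (_) _ (_) _ (Equiv.refl (X × Y)) ?_
    rintro h ⟨x, y⟩
    rfl

/-- The mark of `I` on an `H`-set: its number of `I`-fixed points. -/
noncomputable def mark (I : Subgroup H) : FinGSetClass H →+* ℤ where
  toFun := lift (fun X _ _ => (Nat.card (MulAction.fixedPoints I X) : ℤ))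
    (fun X Y _ _ _ _ e he => by
      congr 1
      refine Nat.card_congr (e.subtypeEquiv fun x => forall_congr' fun i => ?_)
      have := he i x
      change (i : H) • x = x ↔ (i : H) • e x = e x
      rw [← this, e.apply_eq_iff_eq])
  map_zero' := by
    have : IsEmpty (MulAction.fixedPoints I PEmpty.{u + 1}) := ⟨fun x => x.1.elim⟩
    rw [zero_def, lift_mk, Nat.card_of_isEmpty, Nat.cast_zero]
  map_one' := by
    have : MulAction.fixedPoints I PUnit.{u + 1} = Set.univ := by
      ext x; simp
    simp [one_def, this]
  map_add' a b := by
    induction a using ind with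
    | _ X =>
    induction b using ind with
    | _ Y =>
    rw [mk_add, lift_mk, lift_mk, lift_mk, ← Nat.cast_add, ← Nat.card_sum]
    congr 1
    refine Nat.card_congr (Equiv.subtypeSum.trans (Equiv.sumCongr ?_ ?_))
    · refine Equiv.subtypeEquivRight fun x => forall_congr' fun i => ?_
      exact Sum.inl_injective.eq_iff
    · refine Equiv.subtypeEquivRight fun x => forall_congr' fun i => ?_
      exact Sum.inr_injective.eq_iff
  map_mul' a b := by
    induction a using ind with
    | _ X =>
    induction b using ind with
    | _ Y =>
    rw [mk_mul, lift_mk, lift_mk, lift_mk, ← Nat.cast_mul, ← Nat.card_prod]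
    congr 1
    refine Nat.card_congr ((Equiv.subtypeEquivRight fun x => ?_).trans
      (Equiv.subtypeProdEquivProd (p := (· ∈ MulAction.fixedPoints I X))
        (q := (· ∈ MulAction.fixedPoints I Y))))
    simp only [MulAction.mem_fixedPoints, Prod.ext_iff, Prod.smul_fst, Prod.smul_snd,
      forall_and]

/-- Two pairs in `H × X` are identified in `H ×_K X` if they differ by
`(h f(k), x) ∼ (h, k x)`. -/
def balancedSetoid (f : K →* H) (X : Type u) [MulAction K X] : Setoid (H × X) where
  r p q := ∃ k : K, p.1 = q.1 * f k ∧ q.2 = k • p.2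
  iseqv :=
    { refl := fun p => ⟨1, by simp, by simp⟩
      symm := by
        rintro p q ⟨k, h1, h2⟩
        exact ⟨k⁻¹, by simp [h1], by simp [h2]⟩
      trans := by
        rintro p q r ⟨k, h1, h2⟩ ⟨l, h3, h4⟩
        exact ⟨l * k, by simp [h1, h3, mul_assoc], by simp [h2, h4, mul_smul]⟩ }

/-- The induced set `H ×_K X` of a `K`-set `X` along `f : K →* H`. -/
def Ind (f : K →* H) (X : Type u) [MulAction K X] : Type u :=
  Quotient (balancedSetoid f X)

instance (f : K →* H) (X : Type u) [MulAction K X] [Finite X] [Finite H] : Finite (Ind f X) :=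
  inferInstanceAs (Finite (Quotient (balancedSetoid f X)))

/-- `H` acts on `H ×_K X` by left multiplication on the first factor. -/
instance (f : K →* H) (X : Type u) [MulAction K X] : MulAction H (Ind f X) where
  smul h := Quotient.map (fun p => (h * p.1, p.2)) (by
    rintro p q ⟨k, h1, h2⟩
    exact ⟨k, by simp [h1, mul_assoc], h2⟩)
  one_smul := by
    rintro ⟨p⟩
    exact congrArg (Quotient.mk _) (by simp)
  mul_smul := by
    rintro h h' ⟨p⟩
    exact congrArg (Quotient.mk _) (by simp [mul_assoc])

/-- The class of a pair in `H ×_K X`. -/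
def Ind.mk (f : K →* H) {X : Type u} [MulAction K X] (h : H) (x : X) : Ind f X :=
  Quotient.mk (balancedSetoid f X) (h, x)

theorem Ind.mk_eq_mk (f : K →* H) {X : Type u} [MulAction K X] {h h' : H} {x x' : X} :
    Ind.mk f h x = Ind.mk f h' x' ↔ ∃ k : K, h = h' * f k ∧ x' = k • x :=
  Quotient.eq (r := balancedSetoid f X)

theorem Ind.smul_mk (f : K →* H) {X : Type u} [MulAction K X] (g h : H) (x : X) :
    g • Ind.mk f h x = Ind.mk f (g * h) x := rfl

theorem Ind.ind (f : K →* H) {X : Type u} [MulAction K X] {p : Ind f X → Prop}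
    (h : ∀ g x, p (Ind.mk f g x)) (a : Ind f X) : p a :=
  Quotient.ind (fun q => h q.1 q.2) a

/-- The map `H ×_K X → H ×_K Y` induced by an equivariant map. -/
def Ind.map (f : K →* H) {X Y : Type u} [MulAction K X] [MulAction K Y] (e : X → Y)
    (he : ∀ (k : K) (x : X), e (k • x) = k • e x) : Ind f X → Ind f Y :=
  Quotient.map (fun p : H × X => (p.1, e p.2)) (by
    rintro p q ⟨k, h1, h2⟩
    exact ⟨k, h1, by simp [h2, he]⟩)

theorem Ind.map_mk (f : K →* H) {X Y : Type u} [MulAction K X] [MulAction K Y] (e : X → Y)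
    (he : ∀ (k : K) (x : X), e (k • x) = k • e x) (h : H) (x : X) :
    Ind.map f e he (Ind.mk f h x) = Ind.mk f h (e x) := rfl

/-- The map `H ×_K X ⊔ H ×_K Y → H ×_K (X ⊔ Y)`. -/
def Ind.sumMap (f : K →* H) (X Y : Type u) [MulAction K X] [MulAction K Y] :
    Ind f X ⊕ Ind f Y → Ind f (X ⊕ Y) :=
  Sum.elim (Ind.map f Sum.inl fun _ _ => rfl) (Ind.map f Sum.inr fun _ _ => rfl)

theorem Ind.sumMap_smul (f : K →* H) (X Y : Type u) [MulAction K X] [MulAction K Y] (h : H)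
    (a : Ind f X ⊕ Ind f Y) : Ind.sumMap f X Y (h • a) = h • Ind.sumMap f X Y a := by
  rcases a with a | a <;> induction a using Ind.ind <;> rfl

theorem Ind.sumMap_bijective (f : K →* H) (X Y : Type u) [MulAction K X] [MulAction K Y] :
    Function.Bijective (Ind.sumMap f X Y) := by
  constructor
  · rintro (a | a) (b | b) h <;> induction a using Ind.ind with | _ g x => ?_ <;>
      induction b using Ind.ind with | _ g' x' => ?_ <;>
      obtain ⟨k, h1, h2⟩ := (Ind.mk_eq_mk (X := X ⊕ Y) f).1 h
    · exact congrArg Sum.inl ((Ind.mk_eq_mk f).2 ⟨k, h1, Sum.inl_injective h2⟩)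
    · exact absurd h2 Sum.inr_ne_inl
    · exact absurd h2 Sum.inl_ne_inr
    · exact congrArg Sum.inr ((Ind.mk_eq_mk f).2 ⟨k, h1, Sum.inr_injective h2⟩)
  · intro a
    induction a using Ind.ind with
    | _ g z =>
      rcases z with x | y
      · exact ⟨Sum.inl (Ind.mk f g x), rfl⟩
      · exact ⟨Sum.inr (Ind.mk f g y), rfl⟩

/-- Transfer along `f : K →* H`, sending `X` to `H ×_K X`. -/
def tr [Finite H] (f : K →* H) : FinGSetClass K →+ FinGSetClass H where
  toFun := lift (fun X _ _ => mk (Ind f X))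
    (fun X Y _ _ _ _ e he => mk_eq
      (Quotient.congr (Equiv.prodCongr (Equiv.refl H) e) (by
        rintro ⟨h, x⟩ ⟨h', x'⟩
        refine exists_congr fun k => and_congr Iff.rfl ?_
        change x' = k • x ↔ e x' = k • e x
        rw [← he, e.apply_eq_iff_eq]))
      (by rintro h ⟨p⟩; rfl))
  map_zero' := by
    have hE (a : Ind f PEmpty.{u + 1}) : False := by
      induction a using Ind.ind with | _ g x => exact x.elim
    exact mk_eq ⟨fun a => (hE a).elim, fun a => a.elim, fun a => (hE a).elim, fun a => a.elim⟩
      fun _ a => (hE a).elim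
  map_add' a b := by
    induction a using ind with
    | _ X =>
    induction b using ind with
    | _ Y =>
    exact (mk_eq (Equiv.ofBijective _ (Ind.sumMap_bijective f X Y)) (Ind.sumMap_smul f X Y)).symm

/-- The coinduced set `Map_K(H, X)` of a `K`-set `X` along `f : K →* H`. -/
def Coind (f : K →* H) (X : Type u) [MulAction K X] : Type u :=
  {φ : H → X // ∀ (k : K) (h : H), φ (f k * h) = k • φ h}

instance (f : K →* H) (X : Type u) [MulAction K X] [Finite X] [Finite H] : Finite (Coind f X) :=
  inferInstanceAs (Finite {φ : H → X // ∀ (k : K) (h : H), φ (f k * h) = k • φ h})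

/-- `H` acts on `Map_K(H, X)` by `(g φ)(h) = φ (h g)`. -/
instance (f : K →* H) (X : Type u) [MulAction K X] : MulAction H (Coind f X) where
  smul g φ := ⟨fun h => φ.1 (h * g), fun k h =>
    (congrArg φ.1 (mul_assoc (f k) h g)).trans (φ.2 k (h * g))⟩
  one_smul φ := Subtype.ext (funext fun h => congrArg φ.1 (mul_one h))
  mul_smul g g' φ := Subtype.ext (funext fun h => congrArg φ.1 (mul_assoc h g g').symm)

theorem Coind.smul_apply (f : K →* H) (X : Type u) [MulAction K X] (g h : H) (φ : Coind f X) :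
    (g • φ).1 h = φ.1 (h * g) := rfl

/-- The norm of an actual `K`-set `X`, the `H`-set `Map_K(H, X)`. -/
def norm [Finite H] (f : K →* H) : FinGSetClass K → FinGSetClass H :=
  lift (fun X _ _ => mk (Coind f X))
    (fun X Y _ _ _ _ e he => mk_eq
      (Equiv.subtypeEquiv (Equiv.arrowCongr (Equiv.refl H) e) (fun φ => by
        refine forall_congr' fun k => forall_congr' fun h => ?_
        change _ ↔ e (φ (f k * h)) = k • e (φ h)
        rw [← he, e.apply_eq_iff_eq]))
      (fun h φ => rfl))

/-! #### The norm is polynomial -/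

/-- The part of an `H`-set on which an invariant function takes values in `T`. -/
def fiber {Z : Type u} [MulAction H Z] {ι : Type v} (c : Z → ι) (hc : ∀ (h : H) z, c (h • z) = c z)
    (T : Set ι) : SubMulAction H Z where
  carrier := {z | c z ∈ T}
  smul_mem' h z hz := by
    change c (h • z) ∈ T
    rw [hc]
    exact hz

theorem mem_fiber {Z : Type u} [MulAction H Z] {ι : Type v} {c : Z → ι}
    {hc : ∀ (h : H) z, c (h • z) = c z} {T : Set ι} {z : Z} : z ∈ fiber c hc T ↔ c z ∈ T := Iff.rfl

theorem mk_eq_zero (Z : Type u) [MulAction H Z] [Finite Z] [IsEmpty Z] :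
    mk (H := H) Z = 0 :=
  mk_eq (Equiv.equivPEmpty Z) fun _ z => isEmptyElim z

theorem mk_fiber {Z : Type u} [MulAction H Z] [Finite Z] {ι : Type v} [DecidableEq ι] (c : Z → ι)
    (hc : ∀ (h : H) z, c (h • z) = c z) (T : Finset ι) :
    mk (H := H) (fiber c hc (T : Set ι)) = ∑ t ∈ T, mk (H := H) (fiber c hc {t}) := by
  induction T using Finset.induction_on with
  | empty =>
    have : IsEmpty (fiber c hc ((∅ : Finset ι) : Set ι)) :=
      ⟨fun z => by simpa using mem_fiber.1 z.2⟩
    rw [Finset.sum_empty, mk_eq_zero]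
  | insert a T ha ih =>
    rw [Finset.sum_insert ha, ← ih, mk_add]
    have h1 (z) (hz : z ∈ fiber c hc {a}) : z ∈ fiber c hc ((insert a T : Finset ι) : Set ι) := by
      rw [mem_fiber] at hz ⊢
      simp [Set.mem_singleton_iff.1 hz]
    have h2 (z) (hz : z ∈ fiber c hc (T : Set ι)) :
        z ∈ fiber c hc ((insert a T : Finset ι) : Set ι) := by
      rw [mem_fiber] at hz ⊢
      rw [Finset.coe_insert]
      exact Or.inr hz
    symm
    refine mk_eq (Equiv.ofBijective
      (Sum.elim (fun z => ⟨z.1, h1 _ z.2⟩) (fun z => ⟨z.1, h2 _ z.2⟩)) ⟨?_, ?_⟩) ?_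
    · rintro (⟨z, hz⟩ | ⟨z, hz⟩) (⟨w, hw⟩ | ⟨w, hw⟩) h <;>
        obtain rfl : z = w := congrArg Subtype.val h
      · rfl
      · rw [mem_fiber] at hz hw
        exact absurd (hz ▸ hw) ha
      · rw [mem_fiber] at hz hw
        exact absurd (hw ▸ hz) ha
      · rfl
    · rintro ⟨z, hz⟩
      rw [mem_fiber, Finset.coe_insert] at hz
      rcases hz with hz | hz
      · exact ⟨Sum.inl ⟨z, hz⟩, rfl⟩
      · exact ⟨Sum.inr ⟨z, hz⟩, rfl⟩
    · rintro h (z | z) <;> rfl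

theorem mk_sigma (Y : Type u) [MulAction K Y] [Finite Y] (σ : Type) [hσ : Finite σ] :
    mk (H := K) (Σ _ : σ, Y) = Nat.card σ • mk Y := by
  refine @Finite.induction_empty_option
    (fun σ => ∀ [Finite σ], mk (H := K) (Σ _ : σ, Y) = Nat.card σ • mk Y) ?_ ?_ ?_ σ hσ hσ
  · intro α β e ih _
    have := Finite.of_equiv β e.symm
    rw [← Nat.card_congr e, ← ih]
    exact (mk_eq ((Equiv.sigmaCongrLeft (β := fun _ => Y) e)) (by rintro h ⟨i, y⟩; rfl)).symm
  · intro _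
    rw [Nat.card_of_isEmpty, zero_smul, mk_eq_zero]
  · intro α _ ih _
    rw [Finite.card_option, succ_nsmul, ← ih, mk_add]
    refine mk_eq ⟨fun z => match z with
        | ⟨some i, y⟩ => Sum.inl ⟨i, y⟩
        | ⟨none, y⟩ => Sum.inr y,
      Sum.elim (fun z => ⟨some z.1, z.2⟩) (fun y => ⟨none, y⟩), ?_, ?_⟩ ?_
    · rintro ⟨_ | i, y⟩ <;> rfl
    · rintro (⟨i, y⟩ | y) <;> rfl
    · rintro h ⟨_ | i, y⟩ <;> rfl

theorem sum_powerset_sum_powerset {ι : Type*} [DecidableEq ι] {A : Type*} [AddCommGroup A]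
    (U : Finset ι) (g : Finset ι → A) :
    ∑ S ∈ U.powerset, ((-1 : ℤ) ^ S.card) • ∑ T ∈ S.powerset, g T = (-1 : ℤ) ^ U.card • g U := by
  induction U using Finset.induction_on generalizing g with
  | empty => simp
  | insert a U ha ih =>
    rw [Finset.sum_powerset_insert ha, Finset.card_insert_of_notMem ha]
    have (S) (hS : S ∈ U.powerset) :
        ((-1 : ℤ) ^ (insert a S).card) • ∑ T ∈ (insert a S).powerset, g T =
          -(((-1 : ℤ) ^ S.card) • ∑ T ∈ S.powerset, g T) -
            (((-1 : ℤ) ^ S.card) • ∑ T ∈ S.powerset, g (insert a T)) := by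
      have haS : a ∉ S := fun h => ha (Finset.mem_powerset.1 hS h)
      rw [Finset.sum_powerset_insert haS, Finset.card_insert_of_notMem haS, pow_succ, mul_neg_one,
        neg_smul, smul_add]
      abel
    rw [Finset.sum_congr rfl this, Finset.sum_sub_distrib, Finset.sum_neg_distrib,
      ih fun T => g (insert a T), pow_succ, mul_neg_one, neg_smul]
    abel

section
variable (f : K →* H) (X Y : Type u) [MulAction K X] [MulAction K Y] (ι : Type)

open Classical in
/-- The indices of the copies of `Y` that are met by `φ`. -/
noncomputable def support [Fintype ι] (φ : Coind f (X ⊕ Σ _ : ι, Y)) : Finset ι :=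
  Finset.univ.filter fun i => ∃ h y, φ.1 h = Sum.inr ⟨i, y⟩

theorem mem_support [Fintype ι] {φ : Coind f (X ⊕ Σ _ : ι, Y)} {i : ι} :
    i ∈ support f X Y ι φ ↔ ∃ h y, φ.1 h = Sum.inr ⟨i, y⟩ := by
  simp [support]

theorem support_smul [Fintype ι] (h : H) (φ : Coind f (X ⊕ Σ _ : ι, Y)) :
    support f X Y ι (h • φ) = support f X Y ι φ := by
  ext i
  rw [mem_support, mem_support]
  constructor
  · rintro ⟨g, y, hg⟩
    exact ⟨g * h, y, hg⟩
  · rintro ⟨g, y, hg⟩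
    refine ⟨g * h⁻¹, y, ?_⟩
    rw [Coind.smul_apply, inv_mul_cancel_right, hg]

theorem card_support_le [Fintype ι] [Finite H] (φ : Coind f (X ⊕ Σ _ : ι, Y)) :
    (support f X Y ι φ).card ≤ f.range.index := by
  choose g y hg using fun i : support f X Y ι φ => (mem_support f X Y ι).1 i.2
  have hinj : Function.Injective
      fun i : support f X Y ι φ => (QuotientGroup.mk (g i)⁻¹ : H ⧸ f.range) := by
    intro i i' h
    obtain ⟨k, hk⟩ := QuotientGroup.eq.1 h
    have h1 : f k * g i' = g i := by rw [hk]; simp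
    have h2 := φ.2 k (g i')
    rw [h1, hg, hg] at h2
    exact Subtype.ext (congrArg Sigma.fst (Sum.inr_injective h2))
  have := Nat.card_le_card_of_injective _ hinj
  rwa [Nat.card_eq_fintype_card, Fintype.card_coe] at this

theorem mk_coind_subset [Fintype ι] [Finite H] [Finite X] [Finite Y] (S : Finset ι) :
    mk (H := H) (Coind f (X ⊕ Σ _ : S, Y)) =
      mk (fiber (support f X Y ι) (support_smul f X Y ι) (S.powerset : Set (Finset ι))) := by
  let j : (X ⊕ Σ _ : S, Y) → (X ⊕ Σ _ : ι, Y) :=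
    Sum.map id (fun z => ⟨z.1, z.2⟩)
  have hj : Function.Injective j := by
    refine Function.Injective.sumMap Function.injective_id ?_
    rintro ⟨⟨i, hi⟩, y⟩ ⟨⟨i', hi'⟩, y'⟩ h
    simp only [Sigma.mk.injEq, heq_eq_eq] at h
    obtain ⟨rfl, rfl⟩ := h
    rfl
  have hjs (k : K) (z) : j (k • z) = k • j z := by
    rcases z with x | z <;> rfl
  refine mk_eq (Equiv.ofBijective (fun φ => ⟨⟨fun h => j (φ.1 h), ?_⟩, ?_⟩) ⟨?_, ?_⟩) ?_
  · intro k h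
    exact (congrArg j (φ.2 k h)).trans (hjs _ _)
  · change support f X Y ι _ ∈ (S.powerset : Set (Finset ι))
    rw [Finset.mem_coe, Finset.mem_powerset]
    intro i hi
    obtain ⟨h, y, hy⟩ := (mem_support f X Y ι).1 hi
    change j (φ.1 h) = _ at hy
    rcases hφ : φ.1 h with x | ⟨s, z⟩
    · rw [hφ] at hy
      exact absurd hy Sum.inl_ne_inr
    · rw [hφ] at hy
      have : (s : ι) = i := congrArg Sigma.fst (Sum.inr_injective hy)
      exact this ▸ s.2
  · intro φ ψ h
    refine Subtype.ext (funext fun g => hj ?_)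
    exact congrFun (congrArg (fun z => z.1.1) h) g
  · rintro ⟨φ, hφ⟩
    change support f X Y ι φ ∈ (S.powerset : Set (Finset ι)) at hφ
    rw [Finset.mem_coe, Finset.mem_powerset] at hφ
    have hex (h : H) : ∃ z, j z = φ.1 h := by
      rcases hz : φ.1 h with x | ⟨i, y⟩
      · exact ⟨Sum.inl x, rfl⟩
      · exact ⟨Sum.inr ⟨⟨i, hφ ((mem_support f X Y ι).2 ⟨h, y, hz⟩)⟩, y⟩, rfl⟩
    choose ψ hψ using hex
    refine ⟨⟨ψ, fun k h => hj ?_⟩, Subtype.ext (Subtype.ext (funext hψ))⟩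
    rw [hjs, hψ, hψ, φ.2]
  · intro h φ
    rfl

end

theorem norm_isPoly [Finite H] (f : K →* H) :
    GrothendieckRing.IsPolyOfDegreeLE
      (fun a => (GrothendieckRing.of (norm f a) : GrothendieckRing (FinGSetClass H)))
      f.range.index := by
  classical
  intro a b
  induction a using ind with
  | _ X =>
  induction b using ind with
  | _ Y =>
  set n := f.range.index
  let e (T : Finset (Fin (n + 1))) : GrothendieckRing (FinGSetClass H) :=
    GrothendieckRing.of (mk (fiber (support f X Y (Fin (n + 1))) (support_smul f X Y _) {T}))
  have hF (S : Finset (Fin (n + 1))) :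
      GrothendieckRing.of (norm f (mk X + S.card • mk Y)) = ∑ T ∈ S.powerset, e T := by
    have h1 : mk X + S.card • mk Y = mk (H := K) (X ⊕ Σ _ : S, Y) := by
      rw [← mk_add, mk_sigma]
      simp
    rw [h1, ← map_sum, ← mk_fiber, ← mk_coind_subset]
    rfl
  have he : e Finset.univ = 0 := by
    have : mk (H := H) (fiber (support f X Y (Fin (n + 1))) (support_smul f X Y _)
        {Finset.univ}) = 0 := by
      have hE (z : fiber (support f X Y (Fin (n + 1))) (support_smul f X Y _)
          {Finset.univ}) : False := by
        have h1 : support f X Y _ z.1 = Finset.univ := z.2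
        have h2 := card_support_le f X Y _ z.1
        rw [h1, Finset.card_univ, Fintype.card_fin] at h2
        omega
      have := (isEmpty_iff).2 hE
      exact mk_eq_zero _
    simp only [e, this, map_zero]
  have hsum : ∑ S ∈ (Finset.univ : Finset (Fin (n + 1))).powerset,
      ((-1 : ℤ) ^ S.card) • ∑ T ∈ S.powerset, e T = 0 := by
    rw [sum_powerset_sum_powerset, he, smul_zero]
  rw [← hsum]
  simp only [← hF]
  rw [Finset.sum_powerset_apply_card (fun j => ((-1 : ℤ) ^ j) •
    (GrothendieckRing.of (norm f (mk X + j • mk Y)) : GrothendieckRing (FinGSetClass H)))]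
  rw [Finset.card_univ, Fintype.card_fin]
  refine Finset.sum_congr rfl fun j _ => ?_
  rw [mul_comm, mul_smul, natCast_zsmul]

end FinGSetClass

/-- The Burnside ring of `H`: formal differences of isomorphism classes of finite `H`-sets. -/
abbrev BurnsideRing (H : Type u) [Group H] : Type (u + 1) :=
  GrothendieckRing (FinGSetClass H)

namespace BurnsideRing

variable {H K : Type u} [Group H] [Group K]

variable (H) in
/-- The element of the Burnside ring of `H` given by a finite `H`-set. -/
noncomputable def ofSet (X : Type u) [MulAction H X] [Finite X] : BurnsideRing H :=
  GrothendieckRing.of (FinGSetClass.mk X)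

/-- Restriction along `f : K →* H`. -/
noncomputable def res (f : K →* H) : BurnsideRing H →+* BurnsideRing K :=
  GrothendieckRing.lift (GrothendieckRing.of.comp (FinGSetClass.res f))

/-- Transfer along `f : K →* H`, the additive extension of `X ↦ H ×_K X`. -/
noncomputable def tr [Finite H] (f : K →* H) : BurnsideRing K →+ BurnsideRing H :=
  GrothendieckRing.liftAdd
    ((GrothendieckRing.of : FinGSetClass H →+* BurnsideRing H).toAddMonoidHom.comp
      (FinGSetClass.tr f))

/-- Norm along `f : K →* H`, the polynomial extension to formal differences of
`X ↦ Map_K(H, X)`, which is of degree at most the index of the image of `f`. -/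
noncomputable def norm [Finite H] (f : K →* H) : BurnsideRing K → BurnsideRing H :=
  GrothendieckRing.polyExt (fun a => GrothendieckRing.of (FinGSetClass.norm f a)) f.range.index

/-- The mark homomorphism `X ↦ |X^I|`. -/
noncomputable def mark (I : Subgroup H) : BurnsideRing H →+* ℤ :=
  GrothendieckRing.lift (FinGSetClass.mark I)

theorem res_ofSet (f : K →* H) (X : Type u) [MulAction H X] [Finite X] :
    res f (ofSet H X) = @ofSet K _ X (MulAction.compHom X f) _ := by
  rw [res, ofSet, GrothendieckRing.lift_of]
  rfl

theorem tr_ofSet [Finite H] (f : K →* H) (X : Type u) [MulAction K X] [Finite X] :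
    tr f (ofSet K X) = ofSet H (FinGSetClass.Ind f X) := by
  rw [tr, ofSet, GrothendieckRing.liftAdd_of]
  rfl

theorem norm_ofSet [Finite H] (f : K →* H) (X : Type u) [MulAction K X] [Finite X] :
    norm f (ofSet K X) = ofSet H (FinGSetClass.Coind f X) := by
  rw [norm, ofSet, GrothendieckRing.polyExt_of (FinGSetClass.norm_isPoly f)]
  rfl

theorem mark_ofSet (I : Subgroup H) (X : Type u) [MulAction H X] [Finite X] :
    mark I (ofSet H X) = Nat.card (MulAction.fixedPoints I X) := by
  rw [mark, ofSet, GrothendieckRing.lift_of]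
  rfl

end BurnsideRing

/-! ### Ideals of the Burnside Tambara functor

The Burnside Tambara functor of `G` has the value `BurnsideRing H` at `G/H`, for every subgroup
`H` of `G`. -/

namespace BurnsideTambara

section
variable {G : Type u} [Group G]

/-- The conjugate `H^g = g⁻¹ H g`. -/
def conjSubgroup (g : G) (H : Subgroup G) : Subgroup G :=
  H.map (MulAut.conj g⁻¹).toMonoidHom

/-- The homomorphism `x ↦ g x g⁻¹` from `H^g` to `H`. -/
def conjHom (g : G) (H : Subgroup G) : conjSubgroup g H →* H :=
  ((MulAut.conj g).toMonoidHom.comp (conjSubgroup g H).subtype).codRestrict H (by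
    rintro ⟨_, h, hh, rfl⟩
    simpa [mul_assoc] using hh)

/-- Restriction from `G/H` to `G/K`. -/
noncomputable def res {K H : Subgroup G} (h : K ≤ H) : BurnsideRing H →+* BurnsideRing K :=
  BurnsideRing.res (Subgroup.inclusion h)

/-- Transfer from `G/K` to `G/H`. -/
noncomputable def tr [Finite G] {K H : Subgroup G} (h : K ≤ H) : BurnsideRing K →+ BurnsideRing H :=
  BurnsideRing.tr (Subgroup.inclusion h)

/-- Norm from `G/K` to `G/H`. -/
noncomputable def norm [Finite G] {K H : Subgroup G} (h : K ≤ H) : BurnsideRing K → BurnsideRing H :=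
  BurnsideRing.norm (Subgroup.inclusion h)

/-- Conjugation from `G/H` to `G/H^g`. -/
noncomputable def conj (g : G) (H : Subgroup G) :
    BurnsideRing H →+* BurnsideRing (conjSubgroup g H) :=
  BurnsideRing.res (conjHom g H)

variable (G) in
/-- A family of ring ideals, one at each `G/H`. -/
abbrev IdealFamily : Type (u + 1) := ∀ H : Subgroup G, Ideal (BurnsideRing H)

/-- Ideals of the Burnside Tambara functor. -/
structure IsTambaraIdeal [Finite G] (I : IdealFamily G) : Prop where
  res_mem : ∀ {K H : Subgroup G} (h : K ≤ H), ∀ a ∈ I H, res h a ∈ I K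
  tr_mem : ∀ {K H : Subgroup G} (h : K ≤ H), ∀ a ∈ I K, tr h a ∈ I H
  norm_mem : ∀ {K H : Subgroup G} (h : K ≤ H), ∀ a ∈ I K, ∃ b ∈ I H, norm h a = b + norm h 0
  conj_mem : ∀ (g : G) (H : Subgroup G), ∀ a ∈ I H, conj g H a ∈ I (conjSubgroup g H)

/-- The product of two ideals at `G/H`, consisting of the elements `f_+(a b)` for a map of finite
`G`-sets `f : A → G/H`, `a ∈ I(A)` and `b ∈ J(A)`. Since `A` is a finite disjoint union of orbits
`G/K`, on each of which `f` is a conjugation `G/K → G/K^g` followed by the projection to `G/H`,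
these are the finite sums of the elements `tr (c_g (a b))` with `a ∈ I(G/K)`, `b ∈ J(G/K)`. -/
noncomputable def prodLevel [Finite G] (I J : IdealFamily G) (H : Subgroup G) : AddSubmonoid (BurnsideRing H) :=
  AddSubmonoid.closure
    {x | ∃ (K : Subgroup G) (g : G) (h : conjSubgroup g K ≤ H),
      ∃ a ∈ I K, ∃ b ∈ J K, x = tr h (conj g K (a * b))}

/-- Prime ideals of the Burnside Tambara functor. -/
structure IsTambaraPrime [Finite G] (P : IdealFamily G) : Prop where
  isTambaraIdeal : IsTambaraIdeal P
  ne_top : ∃ H, P H ≠ ⊤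
  le_or_le : ∀ I J : IdealFamily G, IsTambaraIdeal I → IsTambaraIdeal J →
    (∀ H, ∀ x ∈ prodLevel I J H, x ∈ P H) → (∀ H, I H ≤ P H) ∨ (∀ H, J H ≤ P H)

/-- `P` lies over `p` if `P(G/e) = (p)`. -/
def LiesOver (P : IdealFamily G) (p : ℕ) : Prop :=
  P ⊥ = Ideal.span {(p : BurnsideRing (⊥ : Subgroup G))}

/-- The family `𝔭_{C,p}`: at `G/H` it is the intersection of the kernels of the marks
`φ_{H,p}^I : A(H) → ℤ/p` for the subgroups `I ≤ H` that are `G`-conjugate to a subgroup of `C`. -/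
noncomputable def markIdeal (C : Subgroup G) (p : ℕ) : IdealFamily G := fun H =>
  ⨅ (I : Subgroup H) (_ : ∃ g : G, conjSubgroup g (I.map H.subtype) ≤ C),
    RingHom.ker ((Int.castRingHom (ZMod p)).comp (BurnsideRing.mark I))

end

end BurnsideTambara

/-! For an integer `q` let `J_q` (`markDvdIdeal`) be the family of elements all of whose marks are
divisible by `q`. As `G` is abelian, marks are explicit: a mark of a transfer is an integer multiple
of a mark of the argument, a mark of a norm is a positive power of one, and restriction and
conjugation only relabel subgroups. Hence `J_q` is a Tambara ideal, and `J_q J_r` lies in `J_{qr}`.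

The heart is that a prime ideal `P` over a prime number `p` contains `J_p` (`markDvdIdeal_le`). The
norm of `p` from the trivial subgroup to `H` is `p` plus a combination of proper orbits `H/K`, so by
induction on `H` some power of `p` lies in `P(G/H)` (`exists_pow_mem`). Since marks determine orbit
coefficients triangularly, an element whose marks are divisible by a large power of `p` is itself
divisible by a prescribed power of `p` (`exists_eq_pow_mul`); so `P` contains `J_q` for `q` a large
power of `p`. As `J_q J_q` lies in `J_{q^2}`, primality halves the exponent repeatedly, down to
`J_p`.

The marks of `H/K` are `0` or `|H:K|`, which gives (1) for prime `p`; for `p = 0` no index is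
divisible by `p`. In a `p`-group all marks agree modulo `p` with the cardinality, so `J_p` is the
ideal attached to the trivial subgroup. It lies in `P` by the above, and it contains `P` because
restriction to `G/e` sends `P` into `(p)`. Its own primality is checked at `G/e`, where it is the
prime ideal `(p)` of the integers. -/

/-! ### Finite differences of integer powers -/

/-- The `n`-th finite difference kills the polynomial `(u + vX)^m`, of degree less than `n`. -/
theorem sum_alternating_choose_mul_pow_eq_zero (u v : ℤ) {m n : ℕ} (h : m < n) :
    ∑ k ∈ Finset.range (n + 1), (-1) ^ k * (n.choose k : ℤ) * (u + k * v) ^ m = 0 := by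
  let P : Polynomial ℤ := (Polynomial.C u + Polynomial.C v * Polynomial.X) ^ m
  have hP : P.natDegree < n := by
    refine lt_of_le_of_lt ?_ h
    have h1 : (Polynomial.C u + Polynomial.C v * Polynomial.X).natDegree ≤ 1 := by
      compute_degree
    exact (Polynomial.natDegree_pow_le_of_le m h1).trans (mul_one m).le
  have := congrFun (Polynomial.fwdDiff_iter_eq_zero_of_degree_lt hP) 0
  rw [fwdDiff_iter_eq_sum_shift] at this
  -- The difference formula carries the sign `(-1)^(n-k)`, which equals `(-1)^n (-1)^k`.
  have key : (-1 : ℤ) ^ n * ∑ k ∈ Finset.range (n + 1),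
      (-1) ^ k * (n.choose k : ℤ) * (u + k * v) ^ m = 0 := by
    rw [Finset.mul_sum]
    refine Eq.trans (Finset.sum_congr rfl fun k hk => ?_) this
    obtain ⟨j, rfl⟩ := Nat.exists_eq_add_of_le (Nat.lt_succ_iff.1 (Finset.mem_range.1 hk))
    have h1 : (-1 : ℤ) ^ k * (-1) ^ k = 1 := by rw [← mul_pow]; simp
    simp only [P, Polynomial.eval_pow, Polynomial.eval_add, Polynomial.eval_mul,
      Polynomial.eval_C, Polynomial.eval_X, smul_eq_mul, nsmul_eq_mul, mul_one, zero_add,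
      Nat.add_sub_cancel_left, pow_add]
    linear_combination ((-1 : ℤ) ^ j * ((k + j).choose k : ℤ) * (u + k * v) ^ m) * h1
  exact (mul_eq_zero.1 key).resolve_left (pow_ne_zero _ (by norm_num))

/-- This makes `polyExt` compatible with power maps. In the vanishing difference of order `n + 1`
based at `x - y` with step `y`, the zeroth term is `(x - y)^m` and term `j + 1` involves `x + j y`.
-/
theorem polyFormula_pow {m n : ℕ} (h : m ≤ n) (x y : ℤ) :
    ∑ j ∈ Finset.range (n + 1), (-1) ^ j * ((n + 1).choose (j + 1) : ℤ) * (x + j * y) ^ m =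
      (x - y) ^ m := by
  have := sum_alternating_choose_mul_pow_eq_zero (x - y) y (Nat.lt_succ_of_le h)
  rw [Finset.sum_range_succ'] at this
  simp only [pow_zero, Nat.choose_zero_right, Nat.cast_one, Nat.cast_zero, zero_mul, add_zero,
    one_mul] at this
  rw [← sub_eq_zero, ← neg_eq_zero, ← this, neg_sub, sub_eq_neg_add, ← Finset.sum_neg_distrib]
  congr 1
  refine Finset.sum_congr rfl fun j _ => ?_
  push_cast
  ring

/-! ### Marks of restricted, induced and coinduced sets -/

namespace FinGSetClass

section
variable {H K : Type u} [Group H] [Group K]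

theorem mark_mk (I : Subgroup H) (X : Type u) [MulAction H X] [Finite X] :
    mark I (mk X) = Nat.card (MulAction.fixedPoints I X) := rfl

theorem mark_res (f : K →* H) (I : Subgroup K) (a : FinGSetClass H) :
    mark I (res f a) = mark (I.map f) a := by
  induction a using ind with
  | _ X =>
  let _ := MulAction.compHom X f
  change ((Nat.card (MulAction.fixedPoints I X) : ℕ) : ℤ) =
    Nat.card (MulAction.fixedPoints (I.map f) X)
  congr 1
  refine Nat.card_congr (Equiv.subtypeEquivRight fun x => ?_)
  constructor
  · rintro h ⟨_, k, hk, rfl⟩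
    exact h ⟨k, hk⟩
  · rintro h ⟨k, hk⟩
    exact h ⟨f k, k, hk, rfl⟩

end

section
variable {H K : Type u} [CommGroup H] [CommGroup K]

/-- Commutativity turns `i • [h, x]` into `[h i, x]`, which equals `[h, x]` exactly when `i = f k`
for some `k` fixing `x`. -/
theorem mem_fixedPoints_ind {f : K →* H} (hf : Function.Injective f) (I : Subgroup H)
    (X : Type u) [MulAction K X] (h : H) (x : X) :
    Ind.mk f h x ∈ MulAction.fixedPoints I (Ind f X) ↔
      I ≤ f.range ∧ x ∈ MulAction.fixedPoints (I.comap f) X := by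
  constructor
  · intro hx
    have (i : I) : ∃ k : K, f k = i ∧ k • x = x := by
      obtain ⟨k, h1, h2⟩ := (Ind.mk_eq_mk f).1 (hx i)
      exact ⟨k, mul_left_cancel (h1.symm.trans (mul_comm _ _)), h2.symm⟩
    refine ⟨fun i hi => ?_, fun k => ?_⟩
    · obtain ⟨k, hk, -⟩ := this ⟨i, hi⟩
      exact ⟨k, hk⟩
    · obtain ⟨l, hl, hx⟩ := this ⟨f k, k.2⟩
      obtain rfl := hf hl
      exact hx
  · rintro ⟨hI, hx⟩ i
    obtain ⟨k, hk⟩ := hI i.2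
    refine (Ind.mk_eq_mk f).2 ⟨k, ?_, (hx ⟨k, ?_⟩).symm⟩
    · rw [hk]
      exact mul_comm _ _
    · rw [Subgroup.mem_comap, hk]
      exact i.2

/-- After choosing coset representatives of `f(K)`, every class has a unique form `[c, x]` with `c`
a representative; being fixed by `I` is then a condition on `x` alone. -/
theorem mark_tr_mk [Finite H] {f : K →* H} (hf : Function.Injective f) (I : Subgroup H)
    (X : Type u) [MulAction K X] [Finite X] (hI : I ≤ f.range) :
    Nat.card (MulAction.fixedPoints I (Ind f X)) =
      f.range.index * Nat.card (MulAction.fixedPoints (I.comap f) X) := by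
  rw [Subgroup.index, ← Nat.card_prod]
  symm
  refine Nat.card_congr (Equiv.ofBijective
    (fun z : (H ⧸ f.range) × MulAction.fixedPoints (I.comap f) X =>
      ⟨Ind.mk f z.1.out z.2.1, (mem_fixedPoints_ind hf I X _ _).2 ⟨hI, z.2.2⟩⟩) ⟨?_, ?_⟩)
  · rintro ⟨c, x, hx⟩ ⟨c', x', hx'⟩ h
    obtain ⟨k, h1, h2⟩ := (Ind.mk_eq_mk f).1 (congrArg Subtype.val h)
    change c.out = c'.out * f k at h1
    change x' = k • x at h2
    have hc : c = c' := by
      rw [← c.out_eq', ← c'.out_eq', h1]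
      exact QuotientGroup.mk_mul_of_mem _ ⟨k, rfl⟩
    subst hc
    have hk : k = 1 := hf (by rw [map_one]; exact (mul_eq_left.1 h1.symm))
    rw [hk, one_smul] at h2
    subst h2
    rfl
  · rintro ⟨a, ha⟩
    induction a using Ind.ind with
    | _ h x =>
    obtain ⟨-, hx⟩ := (mem_fixedPoints_ind hf I X _ _).1 ha
    obtain ⟨⟨_, k, rfl⟩, hk⟩ := QuotientGroup.mk_out_eq_mul f.range h
    refine ⟨⟨(h : H ⧸ f.range), k⁻¹ • x, fun l => ?_⟩, Subtype.ext ?_⟩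
    · change (l : K) • k⁻¹ • x = k⁻¹ • x
      rw [smul_smul, mul_comm, ← smul_smul]
      exact congrArg _ (hx l)
    · refine (Ind.mk_eq_mk f).2 ⟨k, hk, by simp⟩

open Classical in
theorem mark_tr [Finite H] {f : K →* H} (hf : Function.Injective f) (I : Subgroup H)
    (a : FinGSetClass K) :
    mark I (tr f a) = (if I ≤ f.range then f.range.index else 0 : ℕ) * mark (I.comap f) a := by
  induction a using ind with
  | _ X =>
  change ((Nat.card (MulAction.fixedPoints I (Ind f X)) : ℕ) : ℤ) =
    _ * (Nat.card (MulAction.fixedPoints (I.comap f) X) : ℕ)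
  rw [← Nat.cast_mul]
  split_ifs with hI
  · exact congrArg _ (mark_tr_mk hf I X hI)
  · have : IsEmpty (MulAction.fixedPoints I (Ind f X)) := by
      refine ⟨?_⟩
      rintro ⟨a, ha⟩
      induction a using Ind.ind with
      | _ h x => exact hI ((mem_fixedPoints_ind hf I X _ _).1 ha).1
    simp

/-- An `I`-fixed function is controlled on whole cosets of `f(K) I`: equivariance handles `f k`,
invariance handles `i`, and commutativity puts both on the right. -/
theorem coind_apply_of_mem_fixedPoints {f : K →* H} {I : Subgroup H} {X : Type u} [MulAction K X]
    {φ : Coind f X} (hφ : φ ∈ MulAction.fixedPoints I (Coind f X)) (k : K) (i : I) (h : H) :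
    φ.1 (h * (f k * i)) = k • φ.1 h := by
  have h1 : φ.1 (f k * h * i) = φ.1 (f k * h) := congrFun (congrArg Subtype.val (hφ i)) (f k * h)
  rw [← φ.2 k h, ← h1]
  rw [← mul_assoc, mul_comm h]

/-- An `I`-fixed function is freely determined by its values at representatives of the cosets of
`f(K) I`. Each value must be fixed by `f⁻¹(I)`, and this is the only constraint. -/
theorem mark_norm_mk (f : K →* H) (I : Subgroup H) (X : Type u) [MulAction K X] [Finite H] :
    Nat.card (MulAction.fixedPoints I (Coind f X)) =
      Nat.card (MulAction.fixedPoints (I.comap f) X) ^ (f.range ⊔ I).index := by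
  rw [Subgroup.index, ← Nat.card_fun]
  let C := H ⧸ (f.range ⊔ I)
  have hdec (h : H) : ∃ (k : K) (i : I), (h : C).out * (f k * i) = h := by
    obtain ⟨⟨d, hd⟩, hd'⟩ := QuotientGroup.mk_out_eq_mul (f.range ⊔ I) h
    obtain ⟨_, ⟨k, rfl⟩, i, hi, hki⟩ := Subgroup.mem_sup.1 (inv_mem hd)
    exact ⟨k, ⟨i, hi⟩, by simp [hd', hki]⟩
  choose κ ι hκι using hdec
  -- The chosen `κ h` is not canonical, but two choices differ by an element of `f⁻¹(I)`, which
  -- fixes the values of `ψ`.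
  have huniq (ψ : C → MulAction.fixedPoints (I.comap f) X) (h : H) (k : K) (i : I)
      (hki : (h : C).out * (f k * i) = h) : κ h • (ψ h).1 = k • (ψ h).1 := by
    have h1 : f (κ h) * ι h = f k * i := mul_left_cancel ((hκι h).trans hki.symm)
    have h2 : k⁻¹ * κ h ∈ I.comap f := by
      have h3 : f (k⁻¹ * κ h) = i * (ι h : H)⁻¹ := by
        rw [map_mul, map_inv, eq_mul_inv_iff_mul_eq, mul_assoc, h1, inv_mul_cancel_left]
      rw [Subgroup.mem_comap, h3]
      exact mul_mem i.2 (inv_mem (ι h).2)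
    have h3 : (k⁻¹ * κ h) • (ψ h).1 = (ψ h).1 := (ψ h).2 ⟨_, h2⟩
    rw [mul_smul, inv_smul_eq_iff] at h3
    exact h3
  have hmk (h : H) (k : K) (i : I) : ((h * (f k * i) : H) : C) = (h : C) := by
    refine QuotientGroup.mk_mul_of_mem _ (mul_mem ?_ ?_)
    · exact (le_sup_left : f.range ≤ f.range ⊔ I) ⟨k, rfl⟩
    · exact (le_sup_right : I ≤ f.range ⊔ I) i.2
  have hstep (ψ : C → MulAction.fixedPoints (I.comap f) X) (h : H) (k : K) (i : I) :
      κ (h * (f k * i)) • (ψ (h * (f k * i) : H)).1 = k • κ h • (ψ h).1 := by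
    rw [huniq ψ (h * (f k * i)) (k * κ h) (i * ι h), hmk, mul_smul]
    rw [hmk]
    conv_rhs => rw [← hκι h]
    simp only [map_mul, Subgroup.coe_mul]
    ac_rfl
  refine Nat.card_congr ⟨fun φ c => ⟨φ.1.1 c.out, fun k => ?_⟩,
    fun ψ => ⟨⟨fun h => κ h • (ψ h).1, fun k h => ?_⟩, fun i => ?_⟩, fun φ => ?_, fun ψ => ?_⟩
  · have h1 := coind_apply_of_mem_fixedPoints φ.2 k ⟨f k, k.2⟩⁻¹ c.out
    change (k : K) • φ.1.1 c.out = _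
    rw [← h1]
    simp
  · have := hstep ψ h k 1
    rwa [Subgroup.coe_one, mul_one, mul_comm h] at this
  · refine Subtype.ext (funext fun h => ?_)
    have := hstep ψ h 1 i
    rwa [map_one, one_mul, one_smul] at this
  · refine Subtype.ext (Subtype.ext (funext fun h => ?_))
    have := coind_apply_of_mem_fixedPoints φ.2 (κ h) (ι h) (h : C).out
    rw [hκι] at this
    exact this.symm
  · refine funext fun c => Subtype.ext ?_
    have h1 := huniq ψ c.out 1 1
    have h2 : ((c.out : H) : C) = c := c.out_eq'
    rw [h2] at h1
    change κ c.out • (ψ ((c.out : H) : C)).1 = _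
    rw [h2]
    simpa using h1

theorem mark_norm [Finite H] (f : K →* H) (I : Subgroup H) (a : FinGSetClass K) :
    mark I (norm f a) = mark (I.comap f) a ^ (f.range ⊔ I).index := by
  induction a using ind with
  | _ X =>
  change ((Nat.card (MulAction.fixedPoints I (Coind f X)) : ℕ) : ℤ) =
    (Nat.card (MulAction.fixedPoints (I.comap f) X) : ℕ) ^ _
  rw [mark_norm_mk, Nat.cast_pow]

end

/-! ### Decomposition into orbits -/

section
variable {H : Type u} [Group H]

/-- The set `s` consists of one representative per orbit; the orbits are the fibers of the quotient
map. -/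
theorem mk_eq_sum_orbits [Finite H] (X : Type u) [MulAction H X] [Finite X] :
    ∃ (s : Finset X), mk (H := H) X = ∑ x ∈ s, mk (H ⧸ MulAction.stabilizer H x) := by
  classical
  let Ω := MulAction.orbitRel.Quotient H X
  have : Fintype Ω := Fintype.ofFinite Ω
  let c : X → Ω := Quotient.mk _
  have hc (h : H) (x : X) : c (h • x) = c x := Quotient.sound ⟨h, rfl⟩
  have hmk : mk (H := H) X = mk (fiber c hc ((Finset.univ : Finset Ω) : Set Ω)) :=
    mk_eq ⟨fun x => ⟨x, mem_fiber.2 (by simp)⟩, fun x => x.1, fun x => rfl, fun x => rfl⟩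
      fun h x => rfl
  have hout (ω : Ω) : c ω.out = ω := Quotient.out_eq ω
  refine ⟨Finset.univ.image fun ω : Ω => ω.out, ?_⟩
  rw [hmk, mk_fiber, Finset.sum_image fun ω _ ω' _ h => by rw [← hout ω, h, hout]]
  refine Finset.sum_congr rfl fun ω _ => ?_
  symm
  refine mk_eq ((MulAction.orbitEquivQuotientStabilizer H ω.out).symm.trans
    (Equiv.subtypeEquivRight fun x => ?_)) ?_
  · change _ ↔ c x = ω
    conv_rhs => rw [← hout ω]
    exact (Quotient.eq (r := MulAction.orbitRel H X)).symm
  · intro h x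
    induction x using QuotientGroup.induction_on with
    | _ x =>
      refine Subtype.ext ?_
      change ((MulAction.orbitEquivQuotientStabilizer H ω.out).symm ((h * x : H) : _ ⧸ _) : X)
        = h • ((MulAction.orbitEquivQuotientStabilizer H ω.out).symm ((x : H) : _ ⧸ _) : X)
      rw [MulAction.orbitEquivQuotientStabilizer_symm_apply,
        MulAction.orbitEquivQuotientStabilizer_symm_apply, mul_smul]

end

end FinGSetClass

/-! ### Marks and orbit coefficients in the Burnside ring -/

namespace BurnsideRing

section
variable {H K : Type u} [Group H] [Group K]

theorem mark_of (I : Subgroup H) (x : FinGSetClass H) :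
    mark I (GrothendieckRing.of x) = FinGSetClass.mark I x :=
  GrothendieckRing.lift_of _ _

theorem mark_res (f : K →* H) (I : Subgroup K) (a : BurnsideRing H) :
    mark I (res f a) = mark (I.map f) a := by
  obtain ⟨x, y, rfl⟩ := GrothendieckRing.exists_sub a
  simp only [← GrothendieckRing.of_eq_ofAdd, map_sub, mark_of, res, GrothendieckRing.lift_of,
    RingHom.comp_apply, FinGSetClass.mark_res]

theorem exists_eq_sum [Finite H] [Fintype (Subgroup H)] (a : BurnsideRing H) :
    ∃ c : Subgroup H → ℤ, a = ∑ K, c K • ofSet H (H ⧸ K) := by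
  classical
  have hof (x : FinGSetClass H) :
      ∃ c : Subgroup H → ℤ, GrothendieckRing.of x = ∑ K, c K • ofSet H (H ⧸ K) := by
    induction x using FinGSetClass.ind with
    | _ X =>
    obtain ⟨s, hs⟩ := FinGSetClass.mk_eq_sum_orbits (H := H) X
    refine ⟨fun K => ∑ x ∈ s, if MulAction.stabilizer H x = K then 1 else 0, ?_⟩
    simp only [hs, map_sum, Finset.sum_smul]
    rw [Finset.sum_comm]
    refine Finset.sum_congr rfl fun x _ => ?_
    simp only [ite_smul, one_smul, zero_smul, Finset.sum_ite_eq, Finset.mem_univ, if_true]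
    rfl
  obtain ⟨x, y, rfl⟩ := GrothendieckRing.exists_sub a
  obtain ⟨c, hc⟩ := hof x
  obtain ⟨d, hd⟩ := hof y
  refine ⟨c - d, ?_⟩
  simp only [← GrothendieckRing.of_eq_ofAdd, hc, hd, Pi.sub_apply, sub_smul,
    Finset.sum_sub_distrib]

/-- For a `p`-group `I`, the non-fixed points split into orbits of size divisible by `p`. -/
theorem mark_modEq [Finite H] {p : ℕ} [Fact p.Prime] (hH : IsPGroup p H) (I : Subgroup H)
    (a : BurnsideRing H) : ((mark I a : ℤ) : ZMod p) = (mark ⊥ a : ℤ) := by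
  have hset (I : Subgroup H) (X : Type u) [MulAction H X] [Finite X] :
      (Nat.card (MulAction.fixedPoints I X) : ZMod p) = Nat.card X :=
    ((ZMod.natCast_eq_natCast_iff _ _ _).2
      ((hH.to_subgroup I).card_modEq_card_fixedPoints X)).symm
  have hof (x : FinGSetClass H) :
      ((mark I (GrothendieckRing.of x) : ℤ) : ZMod p) =
        (mark ⊥ (GrothendieckRing.of x) : ℤ) := by
    induction x using FinGSetClass.ind with
    | _ X =>
    rw [mark_of, mark_of, FinGSetClass.mark_mk, FinGSetClass.mark_mk, Int.cast_natCast,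
      Int.cast_natCast, hset, hset]
  obtain ⟨x, y, rfl⟩ := GrothendieckRing.exists_sub a
  simp only [← GrothendieckRing.of_eq_ofAdd, map_sub, Int.cast_sub, hof]

theorem ofSet_quotient_top : ofSet H (H ⧸ (⊤ : Subgroup H)) = 1 := by
  have := QuotientGroup.subsingleton_quotient_top (G := H)
  have := Unique.mk' (H ⧸ (⊤ : Subgroup H))
  refine congrArg GrothendieckRing.of (FinGSetClass.mk_eq (Equiv.ofUnique _ PUnit) ?_)
  intro h x
  rfl

theorem tr_one [Finite H] (f : K →* H) {L : Subgroup H} (hL : f.range = L) :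
    tr f 1 = ofSet H (H ⧸ L) := by
  subst hL
  rw [← map_one GrothendieckRing.of, FinGSetClass.one_def]
  refine (tr_ofSet f PUnit).trans (congrArg GrothendieckRing.of ?_)
  refine FinGSetClass.mk_eq (Equiv.ofBijective
    (fun a => Quotient.liftOn a (fun p => (p.1 : H ⧸ f.range)) ?_) ⟨?_, ?_⟩) ?_
  · rintro ⟨h, x⟩ ⟨h', x'⟩ ⟨k, h1, -⟩
    change h = h' * f k at h1
    rw [h1]
    exact QuotientGroup.mk_mul_of_mem _ ⟨k, rfl⟩
  · intro a b hab
    induction a using FinGSetClass.Ind.ind with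
    | _ h x =>
    induction b using FinGSetClass.Ind.ind with
    | _ h' x' =>
    obtain ⟨k, hk⟩ := QuotientGroup.eq.1 (show (h' : H ⧸ f.range) = h from hab.symm)
    exact (FinGSetClass.Ind.mk_eq_mk f).2 ⟨k, by rw [hk, mul_inv_cancel_left], rfl⟩
  · intro c
    induction c using QuotientGroup.induction_on with
    | _ h => exact ⟨FinGSetClass.Ind.mk f h PUnit.unit, rfl⟩
  · intro h a
    induction a using FinGSetClass.Ind.ind with
    | _ h' x => rfl

end

section
variable {H K : Type u} [CommGroup H] [CommGroup K]

open Classical in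
theorem mark_tr [Finite H] {f : K →* H} (hf : Function.Injective f) (I : Subgroup H)
    (a : BurnsideRing K) :
    mark I (tr f a) = (if I ≤ f.range then f.range.index else 0 : ℕ) * mark (I.comap f) a := by
  have hof (x : FinGSetClass K) : mark I (tr f (GrothendieckRing.of x)) =
      (if I ≤ f.range then f.range.index else 0 : ℕ) *
        mark (I.comap f) (GrothendieckRing.of x) := by
    rw [mark_of, tr, GrothendieckRing.liftAdd_of]
    exact (mark_of _ _).trans (FinGSetClass.mark_tr hf I x)
  obtain ⟨x, y, rfl⟩ := GrothendieckRing.exists_sub a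
  simp only [← GrothendieckRing.of_eq_ofAdd, map_sub, hof, mul_sub]

theorem mark_norm [Finite H] (f : K →* H) (I : Subgroup H) (a : BurnsideRing K) :
    mark I (norm f a) = mark (I.comap f) a ^ (f.range ⊔ I).index := by
  obtain ⟨x, y, rfl⟩ := GrothendieckRing.exists_sub a
  rw [← GrothendieckRing.of_eq_ofAdd, ← GrothendieckRing.of_eq_ofAdd, norm,
    GrothendieckRing.polyExt_sub (FinGSetClass.norm_isPoly f), GrothendieckRing.polyFormula,
    map_sum, map_sub]
  simp only [map_zsmul, mark_of, FinGSetClass.mark_norm, map_add, map_nsmul]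
  simp only [smul_eq_mul, nsmul_eq_mul]
  -- The exponent must not exceed the degree `f.range.index` used in the polynomial extension; only
  -- then does the formula return the power of the difference.
  have h : (f.range ⊔ I).index ≤ f.range.index :=
    Nat.le_of_dvd (Nat.pos_of_ne_zero Subgroup.index_ne_zero_of_finite)
      (Subgroup.index_dvd_of_le le_sup_left)
  exact polyFormula_pow h _ _

open Classical in
theorem mark_quotient [Finite H] (I K : Subgroup H) :
    mark I (ofSet H (H ⧸ K)) = (if I ≤ K then K.index else 0 : ℕ) := by
  have := mark_tr K.subtype_injective I 1
  rw [tr_one _ K.range_subtype, map_one, mul_one] at this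
  simpa only [K.range_subtype] using this

/-- Marks determine the coefficients at the transitive sets triangularly. -/
theorem dvd_coeff_mul_index [Finite H] [Fintype (Subgroup H)] {q : ℤ} (c : Subgroup H → ℤ)
    (h : ∀ I, q ∣ mark I (∑ K, c K • ofSet H (H ⧸ K))) (K : Subgroup H) :
    q ∣ c K * K.index := by
  classical
  -- Descending induction: in the mark at `K`, an orbit `H/L` with `L ≠ K` survives only if `L` is
  -- strictly larger than `K`.
  induction K using WellFoundedGT.induction with
  | _ K ih =>
  have hK := h K
  simp only [map_sum, map_zsmul, mark_quotient, smul_eq_mul] at hK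
  rw [← Finset.add_sum_erase _ _ (Finset.mem_univ K)] at hK
  rw [if_pos le_rfl] at hK
  refine (dvd_add_left (Finset.dvd_sum fun L hL => ?_)).1 hK
  split_ifs with hKL
  · exact ih L (lt_of_le_of_ne hKL (Finset.ne_of_mem_erase hL).symm)
  · simp

/-- Passing from marks to coefficients loses only the `p`-part of an index; the surplus exponent
`Nat.card H` is a crude uniform bound for this loss. -/
theorem exists_eq_pow_mul [Finite H] {p : ℕ} (hp : p.Prime) (n : ℕ) (a : BurnsideRing H)
    (h : ∀ I, (p : ℤ) ^ (n + Nat.card H) ∣ mark I a) : ∃ b, a = (p : BurnsideRing H) ^ n * b := by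
  have := Fintype.ofFinite (Subgroup H)
  obtain ⟨c, rfl⟩ := exists_eq_sum a
  have hc (K : Subgroup H) : (p : ℤ) ^ n ∣ c K := by
    have h0 : K.index ≠ 0 := Subgroup.index_ne_zero_of_finite
    obtain ⟨e, m, hm, he⟩ := Nat.exists_eq_pow_mul_and_not_dvd h0 p hp.ne_one
    -- The chain is `e < p^e ≤ |H:K| ≤ |H|`.
    have hcard : e ≤ Nat.card H :=
      (Nat.lt_pow_self hp.one_lt).le.trans <|
        (Nat.le_of_dvd (Nat.pos_of_ne_zero h0) (Dvd.intro m he.symm)).trans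
          (Nat.le_of_dvd Nat.card_pos K.index_dvd_card)
    have h1 := dvd_coeff_mul_index c h K
    rw [he, Nat.cast_mul, Nat.cast_pow, ← mul_assoc] at h1
    have h2 := (Nat.prime_iff_prime_int.1 hp).pow_dvd_of_dvd_mul_right _
      (by rwa [Int.natCast_dvd_natCast]) h1
    have h3 := (pow_dvd_pow (p : ℤ) (Nat.add_le_add_left hcard n)).trans h2
    rw [pow_add] at h3
    exact Int.dvd_of_mul_dvd_mul_right
      (pow_ne_zero _ (Int.natCast_ne_zero.2 hp.ne_zero)) h3
  choose d hd using hc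
  refine ⟨∑ K, d K • ofSet H (H ⧸ K), ?_⟩
  rw [Finset.mul_sum]
  refine Finset.sum_congr rfl fun K _ => ?_
  rw [hd]
  simp only [zsmul_eq_mul]
  push_cast
  ring

end
end BurnsideRing

/-! ### Ideals cut out by divisibility of marks, and prime ideals over `p` -/

namespace BurnsideTambara

variable {G : Type u} [CommGroup G]

/-- The elements of the Burnside rings all of whose marks are divisible by `q`. -/
noncomputable def markDvdIdeal (G : Type u) [CommGroup G] (q : ℤ) : IdealFamily G := fun H =>
  ⨅ I : Subgroup H, (Ideal.span {q}).comap (BurnsideRing.mark I)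

theorem mem_markDvdIdeal {q : ℤ} {H : Subgroup G} {a : BurnsideRing H} :
    a ∈ markDvdIdeal G q H ↔ ∀ I : Subgroup H, q ∣ BurnsideRing.mark I a := by
  simp [markDvdIdeal, Ideal.mem_span_singleton]

theorem mark_bot_res {K H : Subgroup G} (h : K ≤ H) (a : BurnsideRing H) :
    BurnsideRing.mark ⊥ (res h a) = BurnsideRing.mark ⊥ a := by
  rw [res, BurnsideRing.mark_res, Subgroup.map_bot]

theorem mem_markIdeal_bot {p : ℕ} {H : Subgroup G} {a : BurnsideRing H} :
    a ∈ markIdeal ⊥ p H ↔ (p : ℤ) ∣ BurnsideRing.mark ⊥ a := by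
  have (I : Subgroup H) : (∃ g : G, conjSubgroup g (I.map H.subtype) ≤ ⊥) ↔ I = ⊥ := by
    simp only [conjSubgroup, le_bot_iff]
    constructor
    · rintro ⟨g, hg⟩
      rw [Subgroup.map_eq_bot_iff_of_injective _ (MulAut.conj g⁻¹).injective,
        Subgroup.map_eq_bot_iff_of_injective _ H.subtype_injective] at hg
      exact hg
    · rintro rfl
      exact ⟨1, by simp⟩
  simp only [markIdeal, this, iInf_iInf_eq_left, RingHom.mem_ker, RingHom.comp_apply,
    eq_intCast, ZMod.intCast_zmod_eq_zero_iff_dvd]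

variable [Finite G]

theorem mark_tr {K H : Subgroup G} (h : K ≤ H) (I : Subgroup H) (a : BurnsideRing K) :
    ∃ n : ℤ, BurnsideRing.mark I (tr h a) =
      n * BurnsideRing.mark (I.comap (Subgroup.inclusion h)) a :=
  ⟨_, BurnsideRing.mark_tr (Subgroup.inclusion_injective h) I a⟩

/-- There is no function from the nonempty `H` to the empty set. So the correction `norm h 0` in the
ideal axiom disappears. -/
theorem norm_zero {K H : Subgroup G} (h : K ≤ H) : norm h 0 = 0 := by
  have hE : IsEmpty (FinGSetClass.Coind (Subgroup.inclusion h) PEmpty.{u + 1}) :=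
    ⟨fun φ => (φ.1 1).elim⟩
  have h0 : FinGSetClass.norm (Subgroup.inclusion h) 0 = 0 := FinGSetClass.mk_eq_zero _
  have := GrothendieckRing.polyExt_of (FinGSetClass.norm_isPoly (Subgroup.inclusion h)) 0
  rw [map_zero, h0, map_zero] at this
  exact this

theorem markDvdIdeal_isTambaraIdeal (q : ℤ) : IsTambaraIdeal (markDvdIdeal G q) where
  res_mem h a ha := by
    rw [mem_markDvdIdeal] at ha ⊢
    intro I
    rw [res, BurnsideRing.mark_res]
    exact ha _
  tr_mem h a ha := by
    rw [mem_markDvdIdeal] at ha ⊢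
    intro I
    obtain ⟨n, hn⟩ := mark_tr h I a
    exact hn ▸ (ha _).mul_left n
  norm_mem h a ha := by
    refine ⟨norm h a, ?_, by rw [norm_zero, add_zero]⟩
    rw [mem_markDvdIdeal] at ha ⊢
    intro I
    have := BurnsideRing.mark_norm (Subgroup.inclusion h) I a
    rw [norm, this]
    -- The exponent is an index, hence positive; a zeroth power would break divisibility.
    exact (ha _).trans (dvd_pow_self _ Subgroup.index_ne_zero_of_finite)
  conj_mem g H a ha := by
    rw [mem_markDvdIdeal] at ha ⊢
    intro I
    rw [conj, BurnsideRing.mark_res]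
    exact ha _

theorem prodLevel_markDvdIdeal_le (q r : ℤ) (H : Subgroup G) (x : BurnsideRing H)
    (hx : x ∈ prodLevel (markDvdIdeal G q) (markDvdIdeal G r) H) :
    x ∈ markDvdIdeal G (q * r) H := by
  induction hx using AddSubmonoid.closure_induction with
  | zero => exact zero_mem _
  | add x y _ _ hx hy => exact add_mem hx hy
  | mem x hx =>
    obtain ⟨K, g, h, a, ha, b, hb, rfl⟩ := hx
    have hI := markDvdIdeal_isTambaraIdeal (G := G) (q * r)
    refine hI.tr_mem h _ (hI.conj_mem g K _ ?_)
    rw [mem_markDvdIdeal] at ha hb ⊢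
    intro I
    rw [map_mul]
    exact mul_dvd_mul (ha I) (hb I)

/-- With this, `m` times an orbit `H/K` is the transfer of the integer `m` from level `K`, so
closure under transfers applies to it. -/
theorem tr_map_one {H : Subgroup G} (K : Subgroup H) :
    tr (Subgroup.map_subtype_le K) 1 = BurnsideRing.ofSet H (H ⧸ K) := by
  refine BurnsideRing.tr_one _ ?_
  rw [Subgroup.inclusion_range]
  exact Subgroup.comap_map_eq_self_of_injective H.subtype_injective K

/-- A power of `p` lies in every level of an ideal that contains `p` at the bottom level. -/
theorem exists_pow_mem {P : IdealFamily G} (hP : IsTambaraIdeal P) {p : ℕ}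
    (hp : (p : BurnsideRing (⊥ : Subgroup G)) ∈ P ⊥) (H : Subgroup G) :
    ∃ n : ℕ, (p : BurnsideRing H) ^ n ∈ P H := by
  have := Fintype.ofFinite (Subgroup G)
  induction H using WellFoundedLT.induction with
  | _ H ih =>
  -- Finitely many exponents are replaced by their sum, a common exponent for all proper subgroups.
  have ih' : ∃ n : ℕ, ∀ K < H, (p : BurnsideRing K) ^ n ∈ P K := by
    choose! n hn using ih
    refine ⟨∑ K, n K, fun K hK => ?_⟩
    exact Ideal.pow_mem_of_pow_mem _ (hn K hK)
      (Finset.single_le_sum (fun _ _ => Nat.zero_le _) (Finset.mem_univ K))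
  obtain ⟨n, hn⟩ := ih'
  obtain ⟨b, hb, hNb⟩ := hP.norm_mem (bot_le : ⊥ ≤ H) _ hp
  rw [norm_zero, add_zero] at hNb
  have hb' : b = norm (bot_le : ⊥ ≤ H) p := hNb.symm
  have := Fintype.ofFinite (Subgroup H)
  obtain ⟨c, hc⟩ := BurnsideRing.exists_eq_sum b
  classical
  rw [← Finset.add_sum_erase _ _ (Finset.mem_univ ⊤), BurnsideRing.ofSet_quotient_top] at hc
  -- The mark at `⊤` kills every proper orbit, and on the norm of `p` it is `p` to the power of the
  -- index of `⊤`, which is `1`.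
  have hctop : c ⊤ = p := by
    have h1 := congrArg (BurnsideRing.mark ⊤) hc
    rw [map_add, map_zsmul, map_one, map_sum, Finset.sum_eq_zero, hb'] at h1
    · have h2 := BurnsideRing.mark_norm (Subgroup.inclusion (bot_le : ⊥ ≤ H)) ⊤
        (p : BurnsideRing (⊥ : Subgroup G))
      rw [sup_top_eq, Subgroup.index_top, pow_one, map_natCast] at h2
      rw [norm, h2] at h1
      simpa using h1.symm
    · intro K hK
      rw [map_zsmul, BurnsideRing.mark_quotient, if_neg, Nat.cast_zero, smul_zero]
      rw [top_le_iff]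
      exact Finset.ne_of_mem_erase hK
  refine ⟨n + 1, ?_⟩
  -- Multiplying `b = p + ∑ c K • H/K` by `p^n` moves the proper orbits into the ideal, as transfers
  -- of `p^n`.
  have h1 : (p : BurnsideRing H) ^ (n + 1) = (p : BurnsideRing H) ^ n * b -
      ∑ K ∈ Finset.univ.erase (⊤ : Subgroup H),
        c K • ((p : BurnsideRing H) ^ n * BurnsideRing.ofSet H (H ⧸ K)) := by
    rw [hc, hctop, mul_add, Finset.mul_sum]
    simp only [mul_smul_comm, natCast_zsmul, nsmul_eq_mul, mul_one]
    ring
  rw [h1]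
  refine sub_mem (Ideal.mul_mem_left _ _ hb) (sum_mem fun K hK => zsmul_mem ?_ _)
  have hlt : K.map H.subtype < H := by
    refine lt_of_le_of_ne (Subgroup.map_subtype_le K) fun h => Finset.ne_of_mem_erase hK ?_
    rw [← Subgroup.comap_map_eq_self_of_injective H.subtype_injective K, h]
    exact Subgroup.subgroupOf_self H
  have h2 := hP.tr_mem hlt.le _ (hn _ hlt)
  have h3 : tr hlt.le ((p : BurnsideRing (K.map H.subtype)) ^ n) =
      (p : BurnsideRing H) ^ n * BurnsideRing.ofSet H (H ⧸ K) := by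
    rw [← tr_map_one, ← Nat.cast_pow, ← nsmul_one, map_nsmul, ← Nat.cast_pow, nsmul_eq_mul]
  rwa [h3] at h2

/-- The family for `p` behaves as if nilpotent modulo `P`: the families for large powers of `p` lie
in `P`, and primality takes square roots. -/
theorem markDvdIdeal_le {P : IdealFamily G} (hP : IsTambaraPrime P) {p : ℕ} (hp : p.Prime)
    (hPp : LiesOver P p) (H : Subgroup G) : markDvdIdeal G p H ≤ P H := by
  have := Fintype.ofFinite (Subgroup G)
  have hbot : (p : BurnsideRing (⊥ : Subgroup G)) ∈ P ⊥ :=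
    hPp.symm ▸ Ideal.mem_span_singleton_self _
  choose n hn using exists_pow_mem hP.isTambaraIdeal hbot
  -- The sum over subgroups gives one exponent for all levels: `n K` puts a power of `p` in `P K`,
  -- and `Nat.card K` pays for passing from marks to coefficients.
  have hlarge (m : ℕ) (hm : ∑ K, (n K + Nat.card K) ≤ m) (H : Subgroup G) :
      markDvdIdeal G ((p : ℤ) ^ m) H ≤ P H := by
    intro a ha
    rw [mem_markDvdIdeal] at ha
    have hle : n H + Nat.card H ≤ m :=
      (Finset.single_le_sum (f := fun K : Subgroup G => n K + Nat.card K)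
        (fun _ _ => Nat.zero_le _) (Finset.mem_univ H)).trans hm
    obtain ⟨b, rfl⟩ := BurnsideRing.exists_eq_pow_mul hp (n H) a
      fun I => (pow_dvd_pow _ hle).trans (ha I)
    exact Ideal.mul_mem_right _ _ (hn H)
  -- Exponents are powers of two so that squaring the family for `p^(2^m)` lands exactly in that for
  -- `p^(2^(m+1))`.
  have hhalve (m : ℕ) (h : ∀ H, markDvdIdeal G ((p : ℤ) ^ 2 ^ m) H ≤ P H) :
      ∀ H, markDvdIdeal G (p : ℤ) H ≤ P H := by
    induction m with
    | zero => simpa using h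
    | succ m ih =>
      refine ih ((or_self_iff).1 (hP.le_or_le _ _ (markDvdIdeal_isTambaraIdeal _)
        (markDvdIdeal_isTambaraIdeal _) fun H x hx => h H ?_))
      have := prodLevel_markDvdIdeal_le _ _ H x hx
      rwa [← pow_add, ← two_mul, ← pow_succ'] at this
  exact hhalve (∑ K, (n K + Nat.card K)) (hlarge _ (Nat.lt_pow_self one_lt_two).le) H

theorem ofSet_quotient_mem_markDvdIdeal {p : ℕ} {K H : Subgroup G} (h : p ∣ K.relIndex H) :
    BurnsideRing.ofSet H (H ⧸ K.subgroupOf H) ∈ markDvdIdeal G p H := by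
  rw [mem_markDvdIdeal]
  intro I
  rw [BurnsideRing.mark_quotient, Int.natCast_dvd_natCast]
  split_ifs
  exacts [h, dvd_zero p]

theorem markIdeal_bot_eq {p : ℕ} (hp : p.Prime) (hG : IsPGroup p G) :
    markIdeal (⊥ : Subgroup G) p = markDvdIdeal G p := by
  have := Fact.mk hp
  ext H a
  rw [mem_markIdeal_bot, mem_markDvdIdeal]
  refine ⟨fun h I => ?_, fun h => h ⊥⟩
  rw [← ZMod.intCast_zmod_eq_zero_iff_dvd] at h ⊢
  rw [BurnsideRing.mark_modEq (hG.to_subgroup H), h]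

/-- The trivial group has a single transitive set, the point, so its Burnside ring is generated by
`1`. -/
theorem eq_mark_bot (a : BurnsideRing (⊥ : Subgroup G)) :
    a = (BurnsideRing.mark ⊥ a : ℤ) := by
  have := Fintype.ofFinite (Subgroup (⊥ : Subgroup G))
  obtain ⟨c, hc⟩ := BurnsideRing.exists_eq_sum a
  have h : a = (c ⊤ : BurnsideRing (⊥ : Subgroup G)) := by
    rw [hc, Fintype.sum_eq_single ⊤ fun K hK => absurd (Subsingleton.elim K ⊤) hK,
      BurnsideRing.ofSet_quotient_top, zsmul_one]
  rw [h, map_intCast, Int.cast_id]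

theorem markIdeal_bot_liesOver (p : ℕ) : LiesOver (markIdeal (⊥ : Subgroup G) p) p := by
  ext a
  rw [mem_markIdeal_bot, Ideal.mem_span_singleton]
  constructor
  · rintro ⟨n, hn⟩
    rw [eq_mark_bot a, hn]
    exact ⟨n, by push_cast; rfl⟩
  · rintro ⟨b, rfl⟩
    rw [map_mul, map_natCast]
    exact dvd_mul_right _ _

/-- Membership only sees the cardinality modulo `p`, which restriction to `G/e` preserves. Witnesses
of non-containment can thus be restricted there and multiplied, and `p` is prime in the integers. -/
theorem markIdeal_bot_isTambaraPrime {p : ℕ} (hp : p.Prime) (hG : IsPGroup p G) :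
    IsTambaraPrime (markIdeal (⊥ : Subgroup G) p) where
  isTambaraIdeal := markIdeal_bot_eq hp hG ▸ markDvdIdeal_isTambaraIdeal _
  ne_top := by
    refine ⟨⊥, fun h => ?_⟩
    rw [Ideal.eq_top_iff_one, mem_markIdeal_bot, map_one] at h
    exact (Nat.prime_iff_prime_int.1 hp).not_dvd_one h
  le_or_le I J hI hJ hIJ := by
    by_contra! hcon
    obtain ⟨⟨H, hH⟩, ⟨K, hK⟩⟩ := hcon
    obtain ⟨a, ha, ha'⟩ := SetLike.not_le_iff_exists.1 hH
    obtain ⟨b, hb, hb'⟩ := SetLike.not_le_iff_exists.1 hK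
    rw [mem_markIdeal_bot] at ha' hb'
    have h1 : conjSubgroup (1 : G) ⊥ ≤ ⊥ := by simp [conjSubgroup]
    -- At the bottom level with `g = 1`, the transfer has index one and conjugation does not change
    -- the mark, so this generator has mark equal to the product of the two marks.
    have h2 := hIJ ⊥ _ (AddSubmonoid.subset_closure ⟨⊥, 1, h1, _, hI.res_mem bot_le a ha, _,
      hJ.res_mem bot_le b hb, rfl⟩)
    rw [mem_markIdeal_bot] at h2
    rw [tr, conj, BurnsideRing.mark_tr (Subgroup.inclusion_injective h1), if_pos bot_le,
      Subsingleton.elim (Subgroup.inclusion h1).range ⊤, Subgroup.index_top, Nat.cast_one, one_mul,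
      BurnsideRing.mark_res, Subsingleton.elim (Subgroup.map _ _) ⊥, map_mul, mark_bot_res,
      mark_bot_res] at h2
    exact ((Nat.prime_iff_prime_int.1 hp).dvd_or_dvd h2).elim ha' hb'

end BurnsideTambara

theorem theorem4p6 {G : Type*} [CommGroup G] [Finite G] (p : ℕ) (hp : p.Prime ∨ p = 0) :
    (∀ P : BurnsideTambara.IdealFamily G,
      BurnsideTambara.IsTambaraPrime P → BurnsideTambara.LiesOver P p →
        ∀ K H : Subgroup G, K ≤ H → p ∣ K.relIndex H →
          BurnsideRing.ofSet H (H ⧸ K.subgroupOf H) ∈ P H) ∧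
    (p.Prime → IsPGroup p G → ∀ P : BurnsideTambara.IdealFamily G,
      (BurnsideTambara.IsTambaraPrime P ∧ BurnsideTambara.LiesOver P p) ↔
        P = BurnsideTambara.markIdeal ⊥ p) := by
  open BurnsideTambara in
  refine ⟨fun P hP hPp K H _ hdvd => ?_, fun hp hG P => ⟨fun ⟨hP, hPp⟩ => ?_, ?_⟩⟩
  · rcases hp with hp | rfl
    · exact markDvdIdeal_le hP hp hPp H (ofSet_quotient_mem_markDvdIdeal hdvd)
    · exact absurd (zero_dvd_iff.1 hdvd) Subgroup.index_ne_zero_of_finite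
  · refine funext fun H => le_antisymm (fun a ha => ?_) ?_
    -- Both ideals equal `(p)` at `G/e`, and the mark at the trivial subgroup can be read off after
    -- restricting there.
    · have h1 := hP.isTambaraIdeal.res_mem bot_le a ha
      rw [hPp, ← markIdeal_bot_liesOver p, mem_markIdeal_bot, mark_bot_res] at h1
      exact mem_markIdeal_bot.2 h1
    · rw [markIdeal_bot_eq hp hG]
      exact markDvdIdeal_le hP hp hPp H
  · rintro rfl
    exact ⟨markIdeal_bot_isTambaraPrime hp hG, markIdeal_bot_liesOver p⟩
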